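/- **Theorem.** A circular cylinder of radius $r>0$ in Euclidean space $\mathbb{E}^3$ is a surface $\mathcal{C}=\mathrm{bd}(\ell+r\mathbb{B}^3)$, where the line $\ell$ is its axis and $\mathbb{B}^3$ is the closed unit ball; $\mathcal{C}$ encloses a set if the set lies in the convex hull of $\mathcal{C}$. Let $S(p,r)$ be the sphere with center $p$ and radius $r$. Let $\mathcal{P}=\{p_1,\dots,p_m\}$ be a set of $m\ge 4$ points in $\mathbb{E}^3$, not all collinear, and suppose that $\mathcal{P}$ is enclosed in a circular cylinder $\mathcal{C}$ of radius $r$. Then there is a circular cylinder $\mathcal{C}'$ of the same radius $r$, with axis $\ell'$, that encloses $\mathcal{P}$ and satisfies at least one of the following: (i) $\mathcal{C}'$ passes through at least four points of $\mathcal{P}$ that are not all collinear; or (ii) $\mathcal{C}'$ passes through three non-collinear points of $\mathcal{P}$, and for two distinct points $p,q$ among these three one of the following holds: - (a) $\ell'$ is contained in the circular cylinder of radius $r$ whose axis is the line through $p$ and $q$; - (b) $S(p,r)$ and $S(q,r)$ are disjoint, and $\ell'$ is contained in the double cone formed by the lines through the midpoint of $p$ and $q$ that are tangent to both spheres; - (c)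 $S(p,r)$ and $S(q,r)$ are not disjoint, and $\ell'$ is tangent to both spheres and contained in the plane equidistant from $p$ and $q$. Moreover, $\mathcal{C}$ can be transformed into $\mathcal{C}'$ by a continuous motion during which $\mathcal{P}$ stays enclosed: there are isometries $\gamma_t$ of $\mathbb{E}^3$, $t\in[0,1]$, with $(t,x)\mapsto\gamma_t(x)$ continuous, $\gamma_0=\mathrm{id}$ and $\gamma_1(\mathcal{C})=\mathcal{C}'$, such that every cylinder $\gamma_t(\mathcal{C})$ encloses $\mathcal{P}$. -/

import Mathlib

open scoped Pointwise

/-- Euclidean space of dimension three. -/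
abbrev E3 : Type := EuclideanSpace ℝ (Fin 3)

/-- A line is an affine subspace of dimension one. -/
def IsLine (l : AffineSubspace ℝ E3) : Prop :=
  Module.finrank ℝ l.direction = 1

/-- The circular cylinder (a surface) with axis `l` and radius `ρ`: the boundary of the Minkowski
sum of `l` and `ρ` times the closed unit ball. It is used with `l` a line and `0 < ρ`. -/
def cylinder (l : AffineSubspace ℝ E3) (ρ : ℝ) : Set E3 :=
  frontier ((l : Set E3) + ρ • Metric.closedBall (0 : E3) 1)

/-- A set of points is enclosed in a cylinder if it lies in the convex hull of the cylinder. -/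
def EnclosedIn (P C : Set E3) : Prop :=
  P ⊆ convexHull ℝ C

/-- The line `l` is tangent to the sphere with center `p` and radius `r`. -/
def IsTangentToSphere (l : AffineSubspace ℝ E3) (p : E3) (r : ℝ) : Prop :=
  (EuclideanGeometry.Sphere.mk p r).IsTangent l

/-- The cylinder determined by the spheres of radius `r` centered at `p` and `q`: its axis is the
line through the centers and its radius is `r`. -/
def spheresCylinder (p q : E3) (r : ℝ) : Set E3 :=
  cylinder (affineSpan ℝ {p, q}) r

/-- The double cone determined by the (disjoint) spheres of radius `r` centered at `p` and `q`: the
union of the lines through the midpoint of the centers that are tangent to both spheres. -/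
def spheresDoubleCone (p q : E3) (r : ℝ) : Set E3 :=
  {x | ∃ g : AffineSubspace ℝ E3, IsLine g ∧ midpoint ℝ p q ∈ g ∧
    IsTangentToSphere g p r ∧ IsTangentToSphere g q r ∧ x ∈ g}

/-- The set of the lines that are tangent to the two spheres of radius `r` centered at `p` and `q`
and are contained in the plane equidistant from `p` and `q`. -/
def bisectorTangents (p q : E3) (r : ℝ) : Set (AffineSubspace ℝ E3) :=
  {g | IsLine g ∧ IsTangentToSphere g p r ∧ IsTangentToSphere g q r ∧
    g ≤ AffineSubspace.perpBisector p q}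

/-- The line `l` is in one of the three special positions with respect to the spheres of radius `r`
centered at `p` and `q`. -/
def SpecialPosition (l : AffineSubspace ℝ E3) (p q : E3) (r : ℝ) : Prop :=
  (l : Set E3) ⊆ spheresCylinder p q r ∨
  (Disjoint (Metric.sphere p r) (Metric.sphere q r) ∧ (l : Set E3) ⊆ spheresDoubleCone p q r) ∨
  (¬ Disjoint (Metric.sphere p r) (Metric.sphere q r) ∧ l ∈ bisectorTangents p q r)

/-- `C` can be transformed into `C'` by a continuous motion (a continuous family of isometries of
space that starts at the identity) during which the moving surface always encloses `P`. -/
def MovesTo (P C C' : Set E3) : Prop :=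
  ∃ γ : unitInterval → (E3 ≃ᵃⁱ[ℝ] E3),
    Continuous (fun z : unitInterval × E3 => γ z.1 z.2) ∧
    (∀ x, γ 0 x = x) ∧ γ 1 '' C = C' ∧ ∀ t, EnclosedIn P (γ t '' C)

/-! The cylinder is moved until points of `P` block it. A translation orthogonal to the axis brings
its surface to a point `p`; a rotation about the line through `p` parallel to the axis brings it to
a point `q` off that line; turning the axis towards the direction of `q - p`, with `p` and `q` kept
on the surface, brings it to a point `s` off the line through `p` and `q`
(`exists_axisMoves_touch_one`, `_two`, `_three`).

With three non-collinear points on the surface, one degree of freedom remains. A cylinder of radius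
`r` with direction `u` passes through a triangle exactly when the projection of the triangle along
`u` has circumradius `r`. If two vertices have equal heights along `u`, the axis is orthogonal to a
side. Otherwise relabel so that the heights above `p` satisfy `0 < z₂ < z₁`, put `x = z₂ / z₁`, and
let `s` be the squared length of the projection of `u` to the plane of the triangle. Since the
squared circumradius is the product of the squared sides over sixteen times the squared area, the
condition reads `touchFun = 0`.

For fixed `x` this function is strictly convex in `s`, so its zeros bound intervals that vary
continuously with `x`. Following them leads to `x = 0`, `x = 1` or `s = 1`, unless the nonpositive
region has a piece isolated inside the unit square (`exists_joinedIn_zeros`). Such a piece would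
contain a local minimum of the circumradius, which `no_stationary_direction` excludes.
`exists_touching_motion` lifts the curve of zeros to a motion of the cylinder.

If the motion meets another point of `P`, the surface passes through four points. Otherwise it ends
with the axis orthogonal to a side (`x = 0` or `x = 1`), which is position (c), or with the axis in
the direction of the plane (`s = 1`); then a projected side vanishes, the axis is parallel to that
side, and this is position (a). Position (b) is never needed. -/

open scoped RealInnerProductSpace

/-! ### Cylinders as level sets of the squared distance to the axis. -/

/-- The line through `o` with direction `u`. -/
noncomputable def axisLine (o u : E3) : AffineSubspace ℝ E3 := AffineSubspace.mk' o (ℝ ∙ u)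

/-- The squared distance of `x` from the line through `o` with unit direction `u`. -/
noncomputable def axisDistSq (o u x : E3) : ℝ := ‖x - o‖ ^ 2 - ⟪x - o, u⟫ ^ 2

theorem axisDistSq_eq_norm_sq {o u : E3} (hu : ‖u‖ = 1) (x : E3) :
    axisDistSq o u x = ‖x - o - ⟪x - o, u⟫ • u‖ ^ 2 := by
  rw [axisDistSq, norm_sub_sq_real (x - o), inner_smul_right, norm_smul, hu, Real.norm_eq_abs, mul_one,
    sq_abs]
  ring

theorem axisDistSq_add_smul {o u : E3} (hu : ‖u‖ = 1) (x : E3) (c : ℝ) :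
    axisDistSq o u (x + c • u) = axisDistSq o u x := by
  have h1 : x + c • u - o = (x - o) + c • u := by abel
  rw [axisDistSq, axisDistSq, h1, @norm_add_sq_real, inner_add_left, inner_smul_right,
    inner_smul_left, norm_smul, hu, real_inner_self_eq_norm_sq, hu]
  simp
  ring

theorem continuous_axisDistSq {X : Type*} [TopologicalSpace X] {o u x : X → E3}
    (ho : Continuous o) (hu : Continuous u) (hx : Continuous x) :
    Continuous fun t => axisDistSq (o t) (u t) (x t) := by
  unfold axisDistSq
  fun_prop

theorem mem_axisLine {o u x : E3} : x ∈ axisLine o u ↔ ∃ c : ℝ, x = o + c • u := by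
  rw [axisLine, AffineSubspace.mem_mk', vsub_eq_sub, Submodule.mem_span_singleton]
  constructor
  · rintro ⟨c, hc⟩
    exact ⟨c, by rw [hc]; abel⟩
  · rintro ⟨c, rfl⟩
    exact ⟨c, by abel⟩

theorem isLine_axisLine (o : E3) {u : E3} (hu : ‖u‖ = 1) : IsLine (axisLine o u) := by
  rw [IsLine, axisLine, AffineSubspace.direction_mk']
  exact finrank_span_singleton (by rintro rfl; simp at hu)

theorem IsLine.exists_eq_axisLine {l : AffineSubspace ℝ E3} (hl : IsLine l) :
    ∃ o u : E3, ‖u‖ = 1 ∧ l = axisLine o u := by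
  obtain ⟨v, hv, hspan⟩ := finrank_eq_one_iff'.1 hl
  have hne : (l : Set E3).Nonempty := by
    rw [AffineSubspace.nonempty_iff_ne_bot]
    rintro rfl
    rw [IsLine, AffineSubspace.direction_bot, finrank_bot] at hl
    exact zero_ne_one hl
  obtain ⟨o, ho⟩ := hne
  have hv0 : (v : E3) ≠ 0 := by simpa using hv
  refine ⟨o, ‖(v : E3)‖⁻¹ • (v : E3), by simp [norm_smul, hv0], ?_⟩
  have hdir : l.direction = ℝ ∙ (‖(v : E3)‖⁻¹ • (v : E3)) := by
    rw [Submodule.span_singleton_smul_eq (by simpa using hv0)]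
    apply le_antisymm
    · intro w hw
      obtain ⟨c, hc⟩ := hspan ⟨w, hw⟩
      exact Submodule.mem_span_singleton.2 ⟨c, by simpa using congrArg Subtype.val hc⟩
    · rw [Submodule.span_singleton_le_iff_mem]
      exact v.2
  rw [axisLine, ← hdir, AffineSubspace.mk'_eq ho]

theorem solid_eq {o u : E3} (hu : ‖u‖ = 1) {r : ℝ} (hr : 0 < r) :
    (axisLine o u : Set E3) + r • Metric.closedBall (0 : E3) 1 = {x | axisDistSq o u x ≤ r ^ 2} := by
  rw [smul_unitClosedBall, Real.norm_of_nonneg hr.le]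
  ext x
  simp only [Set.mem_add, SetLike.mem_coe, mem_axisLine, Metric.mem_closedBall, dist_zero_right,
    Set.mem_ofPred_eq]
  constructor
  · rintro ⟨_, ⟨c, rfl⟩, y, hy, rfl⟩
    rw [show o + c • u + y = (o + y) + c • u by abel, axisDistSq_add_smul hu, axisDistSq,
      add_sub_cancel_left]
    have := pow_le_pow_left₀ (norm_nonneg y) hy 2
    nlinarith [sq_nonneg ⟪y, u⟫]
  · intro h
    rw [axisDistSq_eq_norm_sq hu] at h
    exact ⟨_, ⟨⟪x - o, u⟫, rfl⟩, x - o - ⟪x - o, u⟫ • u, le_of_sq_le_sq h hr.le, by abel⟩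

theorem axisDistSq_radial {o u k : E3} (hu : ‖u‖ = 1) (hk : ‖k‖ = 1) (hku : ⟪k, u⟫ = 0) (b c : ℝ) :
    axisDistSq o u (o + b • k + c • u) = b ^ 2 := by
  rw [axisDistSq_add_smul hu, axisDistSq, add_sub_cancel_left, norm_smul, hk, inner_smul_left, hku]
  simp

theorem exists_unit_orthogonal (u : E3) : ∃ k : E3, ‖k‖ = 1 ∧ ⟪k, u⟫ = 0 := by
  have h : (ℝ ∙ u)ᗮ ≠ ⊥ := by
    intro h
    rw [Submodule.orthogonal_eq_bot_iff] at h
    have h1 : Module.finrank ℝ (ℝ ∙ u) ≤ 1 := (finrank_span_le_card {u}).trans (by simp)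
    rw [h, finrank_top] at h1
    simp at h1
  obtain ⟨k, hk, hk0⟩ := Submodule.exists_mem_ne_zero_of_ne_bot h
  refine ⟨‖k‖⁻¹ • k, by simp [norm_smul, hk0], ?_⟩
  rw [inner_smul_left, Submodule.mem_orthogonal_singleton_iff_inner_left.1 hk, mul_zero]

/-- A point and its radial unit vector with respect to a line. -/
theorem exists_radial {o u : E3} (hu : ‖u‖ = 1) (x : E3) :
    ∃ (k : E3) (b c : ℝ), ‖k‖ = 1 ∧ ⟪k, u⟫ = 0 ∧ 0 ≤ b ∧ x = o + b • k + c • u ∧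
      axisDistSq o u x = b ^ 2 := by
  set y := x - o - ⟪x - o, u⟫ • u with hy
  by_cases h0 : y = 0
  · obtain ⟨k, hk, hku⟩ := exists_unit_orthogonal u
    refine ⟨k, 0, ⟪x - o, u⟫, hk, hku, le_rfl, ?_, ?_⟩
    · rw [hy, sub_eq_zero] at h0
      rw [← h0]; simp
    · rw [axisDistSq_eq_norm_sq hu, ← hy, h0]; simp
  · have hn : ‖y‖ ≠ 0 := by simpa using h0
    refine ⟨‖y‖⁻¹ • y, ‖y‖, ⟪x - o, u⟫, by simp [norm_smul, h0], ?_, norm_nonneg _, ?_, ?_⟩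
    · have h2 : ⟪y, u⟫ = 0 := by
        rw [hy, inner_sub_left, inner_smul_left, real_inner_self_eq_norm_sq, hu]
        simp
      rw [inner_smul_left, h2, mul_zero]
    · rw [smul_smul, mul_inv_cancel₀ hn, one_smul, hy]; abel
    · rw [axisDistSq_eq_norm_sq hu]

/-- A point at distance exactly `r` is not interior to the solid: pushing it outwards along its
radial vector leaves the solid at once. -/
theorem cylinder_axisLine {o u : E3} (hu : ‖u‖ = 1) {r : ℝ} (hr : 0 < r) :
    cylinder (axisLine o u) r = {x | axisDistSq o u x = r ^ 2} := by
  rw [cylinder, solid_eq hu hr]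
  have hcont : Continuous fun x => axisDistSq o u x :=
    continuous_axisDistSq continuous_const continuous_const continuous_id
  apply subset_antisymm
  · exact frontier_le_subset_eq hcont continuous_const
  · intro x hx
    rw [Set.mem_ofPred_eq] at hx
    rw [(isClosed_le hcont continuous_const).frontier_eq]
    refine ⟨hx.le, fun hint => ?_⟩
    obtain ⟨k, b, c, hk, hku, hb, hxe, hxb⟩ := exists_radial (o := o) hu x
    have hbr : b = r := by
      rw [hx] at hxb
      exact ((sq_eq_sq₀ hr.le hb).1 hxb).symm
    subst hbr
    have hlim : Filter.Tendsto (fun e : ℝ => o + (b + e) • k + c • u) (nhdsWithin 0 (Set.Ioi 0))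
        (nhds x) := by
      have : Continuous fun e : ℝ => o + (b + e) • k + c • u := by fun_prop
      have h2 := this.tendsto 0
      rw [add_zero, ← hxe] at h2
      exact h2.mono_left nhdsWithin_le_nhds
    have hev := hlim.eventually (isOpen_interior.mem_nhds hint)
    obtain ⟨e, he, he0⟩ := (hev.and self_mem_nhdsWithin).exists
    have h3 := interior_subset he
    rw [Set.mem_ofPred_eq, axisDistSq_radial hu hk hku] at h3
    have : (0 : ℝ) < e := he0
    nlinarith

theorem convex_solid {o u : E3} (hu : ‖u‖ = 1) {r : ℝ} (hr : 0 < r) :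
    Convex ℝ {x | axisDistSq o u x ≤ r ^ 2} := by
  rw [← solid_eq hu hr]
  exact (AffineSubspace.convex _).add ((convex_closedBall _ _).smul _)

/-- Each point of the solid lies on a diameter of its circular cross-section, and both ends of the
diameter are on the surface. -/
theorem convexHull_cylinder {o u : E3} (hu : ‖u‖ = 1) {r : ℝ} (hr : 0 < r) :
    convexHull ℝ (cylinder (axisLine o u) r) = {x | axisDistSq o u x ≤ r ^ 2} := by
  rw [cylinder_axisLine hu hr]
  apply subset_antisymm
  · exact convexHull_min (fun x hx => le_of_eq hx) (convex_solid hu hr)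
  · intro x hx
    obtain ⟨k, b, c, hk, hku, hb, hxe, hxb⟩ := exists_radial (o := o) hu x
    rw [Set.mem_ofPred_eq, hxb] at hx
    have hbr : b ≤ r := le_of_sq_le_sq hx hr.le
    have h1 : o + r • k + c • u ∈ {x | axisDistSq o u x = r ^ 2} :=
      axisDistSq_radial hu hk hku r c
    have h2 : o + (-r) • k + c • u ∈ {x | axisDistSq o u x = r ^ 2} := by
      rw [Set.mem_ofPred_eq, axisDistSq_radial hu hk hku]; ring
    refine segment_subset_convexHull h1 h2
      ⟨(r + b) / (2 * r), (r - b) / (2 * r), by positivity,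
        div_nonneg (by linarith) (by positivity), by field_simp; ring, ?_⟩
    rw [hxe]
    have e1 : (r + b) / (2 * r) + (r - b) / (2 * r) = 1 := by field_simp; ring
    have e2 : (r + b) / (2 * r) * r - (r - b) / (2 * r) * r = b := by field_simp; ring
    calc _ = ((r + b) / (2 * r) + (r - b) / (2 * r)) • (o + c • u) +
          ((r + b) / (2 * r) * r - (r - b) / (2 * r) * r) • k := by module
      _ = _ := by rw [e1, e2]; module

theorem enclosedIn_cylinder {o u : E3} (hu : ‖u‖ = 1) {r : ℝ} (hr : 0 < r) {P : Set E3} :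
    EnclosedIn P (cylinder (axisLine o u) r) ↔ ∀ x ∈ P, axisDistSq o u x ≤ r ^ 2 := by
  rw [EnclosedIn, convexHull_cylinder hu hr]
  rfl

/-! ### Motions of cylinders from moving frames. -/

theorem MovesTo.trans {P C C' C'' : Set E3} (h : MovesTo P C C') (h' : MovesTo P C' C'') :
    MovesTo P C C'' := by
  obtain ⟨g, hg, hg0, hg1, hge⟩ := h
  obtain ⟨k, hk, hk0, hk1, hke⟩ := h'
  -- Each motion runs at double speed in its own half of the interval; the clamp `Set.projIcc`
  -- freezes it in the other half.
  let a : unitInterval → unitInterval := fun t => Set.projIcc 0 1 zero_le_one (2 * (t : ℝ))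
  let b : unitInterval → unitInterval := fun t => Set.projIcc 0 1 zero_le_one (2 * (t : ℝ) - 1)
  have ha : Continuous a := continuous_projIcc.comp (by fun_prop)
  have hb : Continuous b := continuous_projIcc.comp (by fun_prop)
  refine ⟨fun t => (g (a t)).trans (k (b t)), ?_, ?_, ?_, ?_⟩
  · exact hk.comp ((hb.comp continuous_fst).prodMk
      (hg.comp ((ha.comp continuous_fst).prodMk continuous_snd)))
  · intro x
    have h1 : a 0 = 0 := by simp [a]
    have h2 : b 0 = 0 := Set.projIcc_of_le_left _ (by simp)
    simp [h1, h2, hg0, hk0]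
  · have h1 : a 1 = 1 := Set.projIcc_of_right_le _ (by norm_num)
    have h2 : b 1 = 1 := Set.projIcc_of_right_le _ (by norm_num)
    simp only [h1, h2]
    rw [← hk1, ← hg1, Set.image_image]
    rfl
  · intro t
    have himg : ((g (a t)).trans (k (b t)) : E3 → E3) '' C = k (b t) '' (g (a t) '' C) := by
      rw [Set.image_image]
      rfl
    rw [himg]
    rcases le_total (2 * (t : ℝ)) 1 with ht | ht
    · have h2 : b t = 0 := Set.projIcc_of_le_left _ (by linarith)
      rw [h2, show (k 0 : E3 → E3) = id from funext hk0, Set.image_id]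
      exact hge _
    · have h1 : a t = 1 := Set.projIcc_of_right_le _ ht
      rw [h1, hg1]
      exact hke _

/-- The cross product of two vectors of Euclidean space. -/
def cross (u v : E3) : E3 := !₂[u 1 * v 2 - u 2 * v 1, u 2 * v 0 - u 0 * v 2, u 0 * v 1 - u 1 * v 0]

theorem inner_eq_sum (u v : E3) : ⟪u, v⟫ = u 0 * v 0 + u 1 * v 1 + u 2 * v 2 := by
  simp [PiLp.inner_apply, Fin.sum_univ_three, mul_comm]

theorem inner_cross_left (u v : E3) : ⟪cross u v, u⟫ = 0 := by
  rw [inner_eq_sum]; simp [cross]; ring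

theorem inner_cross_right (u v : E3) : ⟪cross u v, v⟫ = 0 := by
  rw [inner_eq_sum]; simp [cross]; ring

theorem norm_cross_sq (u v : E3) : ‖cross u v‖ ^ 2 = ‖u‖ ^ 2 * ‖v‖ ^ 2 - ⟪u, v⟫ ^ 2 := by
  simp only [← real_inner_self_eq_norm_sq, inner_eq_sum]
  simp [cross]; ring

theorem continuous_cross {X : Type*} [TopologicalSpace X] {u v : X → E3}
    (hu : Continuous u) (hv : Continuous v) : Continuous fun t => cross (u t) (v t) := by
  unfold cross
  apply (PiLp.continuous_toLp 2 _).comp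
  refine continuous_pi fun i => ?_
  fin_cases i <;> simp <;> fun_prop

theorem orthonormal_triple {u v : E3} (hu : ‖u‖ = 1) (hv : ‖v‖ = 1) (huv : ⟪v, u⟫ = 0) :
    Orthonormal ℝ ![u, v, cross u v] := by
  have h1 : ‖cross u v‖ = 1 := by
    have := norm_cross_sq u v
    rw [hu, hv, real_inner_comm, huv] at this
    nlinarith [norm_nonneg (cross u v)]
  have h2 := inner_cross_left u v
  have h3 := inner_cross_right u v
  constructor
  · intro i; fin_cases i <;> simp [hu, hv, h1]
  · intro i j hij
    fin_cases i <;> fin_cases j <;> simp_all [real_inner_comm]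

/-- The orthonormal basis of space that starts with two given orthonormal vectors. -/
noncomputable def frame {u v : E3} (hu : ‖u‖ = 1) (hv : ‖v‖ = 1) (huv : ⟪v, u⟫ = 0) :
    OrthonormalBasis (Fin 3) ℝ E3 :=
  OrthonormalBasis.mk (orthonormal_triple hu hv huv)
    ((orthonormal_triple hu hv huv).linearIndependent.span_eq_top_of_card_eq_finrank'
      (by simp)).ge

theorem frame_apply {u v : E3} (hu : ‖u‖ = 1) (hv : ‖v‖ = 1) (huv : ⟪v, u⟫ = 0) (i : Fin 3) :
    frame hu hv huv i = ![u, v, cross u v] i := by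
  simp [frame]

/-- The unit normal `k` completes the direction `u` to a moving orthonormal frame. The isometry at
time `t` carries the frame and origin at time `0` to those at time `t`. Supplying `k` makes the
frame explicit, hence visibly continuous. -/
theorem exists_motion {o u k : unitInterval → E3} (ho : Continuous o) (hu : Continuous u)
    (hk : Continuous k) (hu1 : ∀ t, ‖u t‖ = 1) (hk1 : ∀ t, ‖k t‖ = 1)
    (hku : ∀ t, ⟪k t, u t⟫ = 0) {r : ℝ} (hr : 0 < r) {P : Set E3}
    (hP : ∀ t, ∀ x ∈ P, axisDistSq (o t) (u t) x ≤ r ^ 2) :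
    MovesTo P (cylinder (axisLine (o 0) (u 0)) r) (cylinder (axisLine (o 1) (u 1)) r) := by
  let b : unitInterval → OrthonormalBasis (Fin 3) ℝ E3 := fun t => frame (hu1 t) (hk1 t) (hku t)
  let T : unitInterval → (E3 ≃ₗᵢ[ℝ] E3) := fun t => (b 0).equiv (b t) (Equiv.refl _)
  let g : unitInterval → (E3 ≃ᵃⁱ[ℝ] E3) := fun t =>
    AffineIsometryEquiv.mk' (fun x => T t (x - o 0) + o t) (T t) (o 0) (by intro x; simp)
  have hg : ∀ t x, g t x = T t (x - o 0) + o t := fun t x => rfl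
  have hT : ∀ t x, T t x = ∑ i, ⟪b 0 i, x⟫ • b t i := by
    intro t x
    simp only [T, OrthonormalBasis.equiv_apply]
    simp [OrthonormalBasis.repr_apply_apply]
  have hTu : ∀ t, T t (u 0) = u t := by
    intro t
    have h0 : ∀ t, u t = b t 0 := fun t => by simp [b, frame_apply]
    rw [h0 0, h0 t]
    simp [T]
  have himg : ∀ t, g t '' cylinder (axisLine (o 0) (u 0)) r = cylinder (axisLine (o t) (u t)) r := by
    intro t
    have hinv : ∀ x, axisDistSq (o t) (u t) (g t x) = axisDistSq (o 0) (u 0) x := by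
      intro x
      rw [axisDistSq, hg, add_sub_cancel_right, LinearIsometryEquiv.norm_map, ← hTu t,
        LinearIsometryEquiv.inner_map_map, axisDistSq]
    rw [cylinder_axisLine (hu1 0) hr, cylinder_axisLine (hu1 t) hr]
    ext y
    constructor
    · rintro ⟨x, hx, rfl⟩
      rw [Set.mem_ofPred_eq, hinv]
      exact hx
    · intro hy
      refine ⟨(g t).symm y, ?_, by simp⟩
      rw [Set.mem_ofPred_eq, ← hinv]
      simpa using hy
  refine ⟨g, ?_, ?_, himg 1, ?_⟩
  · simp only [hg, hT]
    have hb : ∀ i, Continuous fun t => b t i := by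
      intro i
      simp only [b, frame_apply]
      fin_cases i
      · exact hu
      · exact hk
      · exact continuous_cross hu hk
    refine Continuous.add (continuous_finsetSum _ fun i _ => ?_) (ho.comp continuous_fst)
    have hi : Continuous fun z : unitInterval × E3 => ⟪b 0 i, z.2 - o 0⟫ := by fun_prop
    exact hi.smul ((hb i).comp continuous_fst)
  · intro x
    rw [hg]
    have : T 0 = LinearIsometryEquiv.refl ℝ E3 := by simp [T]
    rw [this]
    simp
  · intro t
    rw [himg t, enclosedIn_cylinder (hu1 t) hr]
    exact hP t

/-! ### Moving the cylinder until its surface meets one, two and three points. -/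

theorem exists_first_hit {ι : Type*} (S : Finset ι) (f : ι → unitInterval → ℝ)
    (hf : ∀ i ∈ S, Continuous (f i)) {c : ℝ} (h0 : ∀ i ∈ S, f i 0 ≤ c) :
    ∃ t₀, (∀ t ≤ t₀, ∀ i ∈ S, f i t ≤ c) ∧ (t₀ = 1 ∨ ∃ i ∈ S, f i t₀ = c) := by
  set A : Set unitInterval := ⋃ i ∈ S, {t | c ≤ f i t} with hA
  have hmem : ∀ t, t ∈ A ↔ ∃ i ∈ S, c ≤ f i t := by intro t; simp [hA]
  have hclosed : IsClosed A :=
    S.finite_toSet.isClosed_biUnion fun i hi => isClosed_le continuous_const (hf i hi)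
  rcases A.eq_empty_or_nonempty with he | hne
  · refine ⟨1, fun t _ i hi => ?_, Or.inl rfl⟩
    by_contra hlt
    have : t ∈ A := (hmem t).2 ⟨i, hi, (not_le.1 hlt).le⟩
    simp [he] at this
  · obtain ⟨t₀, ht₀, hmin⟩ := hclosed.isCompact.exists_isLeast hne
    have hlt : ∀ t < t₀, ∀ i ∈ S, f i t ≤ c := by
      intro t ht i hi
      by_contra hcon
      exact absurd (hmin ((hmem t).2 ⟨i, hi, (not_le.1 hcon).le⟩)) (not_le.2 ht)
    have heq : ∀ i ∈ S, f i t₀ ≤ c := by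
      intro i hi
      rcases eq_or_ne t₀ 0 with h | h
      · rw [h]; exact h0 i hi
      · have : (nhdsWithin t₀ (Set.Iio t₀)).NeBot :=
          nhdsLT_neBot_of_exists_lt ⟨0, unitInterval.pos_iff_ne_zero.2 h⟩
        have hev : ∀ᶠ t in nhdsWithin t₀ (Set.Iio t₀), f i t ≤ c := by
          filter_upwards [self_mem_nhdsWithin] with t ht using hlt t ht i hi
        exact le_of_tendsto (((hf i hi).tendsto t₀).mono_left nhdsWithin_le_nhds) hev
    obtain ⟨i, hi, hic⟩ := (hmem t₀).1 ht₀
    refine ⟨t₀, fun t ht i hi => ?_, Or.inr ⟨i, hi, le_antisymm (heq i hi) hic⟩⟩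
    rcases ht.eq_or_lt with h | h
    · rw [h]; exact heq i hi
    · exact hlt t h i hi

/-- The cylinder of radius `r` around the line through `o` with direction `u` can be moved to the
one around the line through `o'` with unit direction `u'`, the set `P` staying enclosed. -/
def AxisMoves (P : Finset E3) (r : ℝ) (o u o' u' : E3) : Prop :=
  ‖u'‖ = 1 ∧ (∀ x ∈ P, axisDistSq o' u' x ≤ r ^ 2) ∧
    MovesTo (P : Set E3) (cylinder (axisLine o u) r) (cylinder (axisLine o' u') r)

theorem AxisMoves.trans {P : Finset E3} {r : ℝ} {o u o' u' o'' u'' : E3}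
    (h : AxisMoves P r o u o' u') (h' : AxisMoves P r o' u' o'' u'') :
    AxisMoves P r o u o'' u'' :=
  ⟨h'.1, h'.2.1, h.2.2.trans h'.2.2⟩

/-- `S` marks the points that may stop the motion; the others are known to stay enclosed throughout,
usually because the motion is designed to keep them on the surface. The end `t₀ = 1` covers the case
of no hit. -/
theorem exists_motion_until_hit {P : Finset E3} {r : ℝ} (hr : 0 < r) (S : E3 → Prop)
    {o u k : unitInterval → E3} (ho : Continuous o) (hu : Continuous u)
    (hk : Continuous k) (hu1 : ∀ t, ‖u t‖ = 1) (hk1 : ∀ t, ‖k t‖ = 1)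
    (hku : ∀ t, ⟪k t, u t⟫ = 0)
    (h0 : ∀ x ∈ P, axisDistSq (o 0) (u 0) x ≤ r ^ 2)
    (hS : ∀ x ∈ P, ¬ S x → ∀ t, axisDistSq (o t) (u t) x ≤ r ^ 2) :
    ∃ t₀, AxisMoves P r (o 0) (u 0) (o t₀) (u t₀) ∧
      (t₀ = 1 ∨ ∃ x ∈ P, S x ∧ axisDistSq (o t₀) (u t₀) x = r ^ 2) := by
  classical
  obtain ⟨t₀, hle, hend⟩ := exists_first_hit (P.filter S) (fun x t => axisDistSq (o t) (u t) x)
    (fun x _ => continuous_axisDistSq ho hu continuous_const)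
    (fun x hx => h0 x (Finset.mem_filter.1 hx).1)
  have hall : ∀ t ≤ t₀, ∀ x ∈ P, axisDistSq (o t) (u t) x ≤ r ^ 2 := by
    intro t ht x hx
    by_cases hSx : S x
    · exact hle t ht x (Finset.mem_filter.2 ⟨hx, hSx⟩)
    · exact hS x hx hSx t
  refine ⟨t₀, ⟨hu1 _, hall t₀ le_rfl, ?_⟩, ?_⟩
  · have hc : Continuous fun t : unitInterval => t₀ * t := continuous_const.mul continuous_id
    have := exists_motion (P := (P : Set E3)) (ho.comp hc) (hu.comp hc) (hk.comp hc)
      (fun t => hu1 _) (fun t => hk1 _) (fun t => hku _) hr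
      (fun t => hall _ unitInterval.mul_le_left)
    simpa using this
  · rcases hend with h | ⟨x, hx, hxe⟩
    · exact Or.inl h
    · exact Or.inr ⟨x, (Finset.mem_filter.1 hx).1, (Finset.mem_filter.1 hx).2, hxe⟩

theorem axisLine_add_smul (o u : E3) (c : ℝ) : axisLine (o + c • u) u = axisLine o u := by
  ext x
  simp only [mem_axisLine]
  constructor
  · rintro ⟨d, rfl⟩
    exact ⟨c + d, by module⟩
  · rintro ⟨d, rfl⟩
    exact ⟨d - c, by module⟩

theorem axisDistSq_origin_add_smul {u : E3} (hu : ‖u‖ = 1) (o x : E3) (c : ℝ) :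
    axisDistSq (o + c • u) u x = axisDistSq o u x := by
  have h := axisDistSq_add_smul (o := o + c • u) hu x c
  rw [← h, axisDistSq, axisDistSq, add_sub_add_right_eq_sub]

theorem exists_axisMoves_touch_one {P : Finset E3} {r : ℝ} (hr : 0 < r) {o u x₀ : E3}
    (hu : ‖u‖ = 1) (h : ∀ x ∈ P, axisDistSq o u x ≤ r ^ 2) (hx₀ : x₀ ∈ P) :
    ∃ o', AxisMoves P r o u o' u ∧ ∃ p ∈ P, axisDistSq o' u p = r ^ 2 := by
  obtain ⟨k, b, c, hk, hku, hb, hxe, -⟩ := exists_radial (o := o) hu x₀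
  -- A shift by `2 * r` away from `x₀` would put `x₀` outside the cylinder, so a hit is forced.
  obtain ⟨t, ht, hend⟩ := exists_motion_until_hit (P := P) hr (fun _ => True)
    (o := fun t => o - (2 * r * t : ℝ) • k) (u := fun _ => u) (k := fun _ => k)
    (by fun_prop) continuous_const continuous_const (fun _ => hu) (fun _ => hk) (fun _ => hku)
    (by simpa using h) (by simp)
  refine ⟨_, by simpa using ht, ?_⟩
  rcases hend with rfl | ⟨p, hp, -, hpe⟩
  · have h1 := ht.2.1 x₀ hx₀
    have h2 : x₀ = o - (2 * r * ((1 : unitInterval) : ℝ)) • k + (b + 2 * r) • k + c • u := by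
      rw [show ((1 : unitInterval) : ℝ) = 1 from rfl, hxe]; module
    rw [h2, axisDistSq_radial hu hk hku] at h1
    nlinarith
  · exact ⟨p, hp, hpe⟩

/-- A half-turn about the line through `p` parallel to the axis carries the solid to the other side
of its tangent plane at `p`. The two solids meet only in that line, so the enclosed point `x₀` off
the line forces a hit. -/
theorem exists_axisMoves_touch_two {P : Finset E3} {r : ℝ} (hr : 0 < r) {o u p x₀ : E3}
    (hu : ‖u‖ = 1) (h : ∀ x ∈ P, axisDistSq o u x ≤ r ^ 2) (hp : axisDistSq o u p = r ^ 2)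
    (hx₀ : x₀ ∈ P) (hx₀p : ¬ ∃ c : ℝ, x₀ = p + c • u) :
    ∃ o', AxisMoves P r o u o' u ∧ axisDistSq o' u p = r ^ 2 ∧
      ∃ q ∈ P, axisDistSq o' u q = r ^ 2 ∧ ¬ ∃ c : ℝ, q = p + c • u := by
  obtain ⟨k, b, c, hk, hku, hb, hpe, hpb⟩ := exists_radial (o := o) hu p
  have hbr : b = r := by
    rw [hp] at hpb
    exact ((sq_eq_sq₀ hr.le hb).1 hpb).symm
  subst hbr
  have hl : ‖cross u k‖ = 1 := by
    simpa using (orthonormal_triple hu hk hku).1 2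
  have hlu : ⟪cross u k, u⟫ = 0 := inner_cross_left u k
  have hlk : ⟪cross u k, k⟫ = 0 := inner_cross_right u k
  set l := cross u k
  let n : unitInterval → E3 := fun t => Real.cos (Real.pi * t) • k + Real.sin (Real.pi * t) • l
  have hnu : ∀ t, ⟪n t, u⟫ = 0 := by
    intro t
    simp [n, inner_add_left, inner_smul_left, hku, hlu]
  have hn1 : ∀ t, ‖n t‖ = 1 := by
    intro t
    have : ‖n t‖ ^ 2 = 1 := by
      simp only [n]
      rw [norm_add_sq_real, norm_smul, norm_smul, inner_smul_left, inner_smul_right,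
        real_inner_comm, hlk, hk, hl]
      simp
    nlinarith [norm_nonneg (n t)]
  have hnc : Continuous n := by fun_prop
  have hpt : ∀ t, axisDistSq (p - b • n t) u p = b ^ 2 := by
    intro t
    have := axisDistSq_radial (o := p - b • n t) hu (hn1 t) (hnu t) b 0
    simpa using this
  have hn0 : n 0 = k := by simp [n]
  have ho : p - b • n 0 = o + c • u := by rw [hn0, hpe]; abel
  obtain ⟨t, ht, hend⟩ := exists_motion_until_hit (P := P) hr (fun x => ¬ ∃ c : ℝ, x = p + c • u)
    (o := fun t => p - b • n t) (u := fun _ => u) (k := n)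
    (by fun_prop) continuous_const hnc (fun _ => hu) hn1 hnu
    (by simp only [ho, axisDistSq_origin_add_smul hu]; exact h)
    (by
      intro x _ hx t
      obtain ⟨c, rfl⟩ := not_not.1 hx
      rw [axisDistSq_add_smul hu, hpt])
  refine ⟨_, ?_, hpt t, ?_⟩
  · rwa [AxisMoves, ho, axisLine_add_smul] at ht
  · rcases hend with rfl | ⟨q, hq, hqp, hqe⟩
    · exfalso
      have h1 := ht.2.1 x₀ hx₀
      have h2 := h x₀ hx₀
      rw [← axisDistSq_origin_add_smul hu o x₀ c, ← ho, hn0] at h2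
      have hn1' : n 1 = -k := by simp [n]
      simp only [hn1'] at h1
      apply hx₀p
      refine ⟨⟪x₀ - p, u⟫, ?_⟩
      have e1 : x₀ - (p - b • -k) = (x₀ - p) - b • k := by module
      have e2 : x₀ - (p - b • k) = (x₀ - p) + b • k := by module
      -- Adding the distance inequalities for the two extreme axes cancels the terms linear in `k`.
      have h3 : ‖x₀ - p - ⟪x₀ - p, u⟫ • u‖ ^ 2 ≤ 0 := by
        rw [← axisDistSq_eq_norm_sq hu, axisDistSq]
        rw [axisDistSq, e1, norm_sub_sq_real (x₀ - p), inner_sub_left (x₀ - p), inner_smul_left, inner_smul_right, hku,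
          norm_smul, hk] at h1
        rw [axisDistSq, e2, norm_add_sq_real, inner_add_left, inner_smul_left, inner_smul_right, hku,
          norm_smul, hk] at h2
        simp at h1 h2
        linarith
      have h4 : x₀ - p - ⟪x₀ - p, u⟫ • u = 0 := by
        rw [← norm_eq_zero]
        nlinarith [norm_nonneg (x₀ - p - ⟪x₀ - p, u⟫ • u)]
      rw [← sub_eq_zero, ← h4]
      abel
    · exact ⟨q, hq, hqe, hqp⟩

theorem exists_unit_orthogonal_pair (u e : E3) : ∃ k : E3, ‖k‖ = 1 ∧ ⟪k, u⟫ = 0 ∧ ⟪k, e⟫ = 0 := by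
  have h : (Submodule.span ℝ {u, e})ᗮ ≠ ⊥ := by
    intro h
    rw [Submodule.orthogonal_eq_bot_iff] at h
    have h1 : Module.finrank ℝ (Submodule.span ℝ ({u, e} : Set E3)) ≤ 2 :=
      (finrank_span_le_card ({u, e} : Set E3)).trans (by
        rw [Set.toFinset_insert, Set.toFinset_singleton]; exact Finset.card_le_two)
    rw [h, finrank_top] at h1
    simp at h1
  obtain ⟨k, hk, hk0⟩ := Submodule.exists_mem_ne_zero_of_ne_bot h
  have hk' : ∀ v ∈ ({u, e} : Set E3), ⟪k, v⟫ = 0 := fun v hv =>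
    (Submodule.mem_orthogonal' _ _).1 hk v (Submodule.subset_span hv)
  refine ⟨‖k‖⁻¹ • k, by simp [norm_smul, hk0], ?_, ?_⟩
  · rw [inner_smul_left, hk' u (by simp), mul_zero]
  · rw [inner_smul_left, hk' e (by simp), mul_zero]

/-- If two points on a direction `e` from `m`, symmetric about `m`, are equally far from a line,
then `m` projects to the line orthogonally to `e`. -/
theorem exists_common_normal {o u m e : E3} {a : ℝ} (hu : ‖u‖ = 1) (ha : a ≠ 0)
    (h : axisDistSq o u (m + a • e) = axisDistSq o u (m - a • e)) :
    ∃ (k : E3) (b c : ℝ), ‖k‖ = 1 ∧ ⟪k, u⟫ = 0 ∧ ⟪k, e⟫ = 0 ∧ 0 ≤ b ∧ m + b • k = o + c • u := by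
  obtain ⟨k, b, c, hk, hku, hb, hm, -⟩ := exists_radial (o := o) hu m
  rcases hb.eq_or_lt with hb0 | hb0
  · obtain ⟨k', hk', hku', hke'⟩ := exists_unit_orthogonal_pair u e
    exact ⟨k', 0, c, hk', hku', hke', le_rfl, by rw [hm, ← hb0]; simp⟩
  · refine ⟨-k, b, c, by simpa using hk, by simp [hku], ?_, hb, by rw [hm]; module⟩
    have e1 : m + a • e - o = (b • k + c • u) + a • e := by rw [hm]; abel
    have e2 : m - a • e - o = (b • k + c • u) - a • e := by rw [hm]; abel
    have huu : ⟪u, u⟫ = 1 := by rw [real_inner_self_eq_norm_sq, hu]; simp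
    rw [axisDistSq, axisDistSq, e1, e2, norm_add_sq_real (b • k + c • u),
      norm_sub_sq_real (b • k + c • u)] at h
    simp only [inner_add_left, inner_sub_left, inner_smul_left, inner_smul_right, hku, huu] at h
    rw [real_inner_comm e u] at h
    simp at h
    have h4 : a * b * ⟪k, e⟫ = 0 := by linarith
    simpa [ha, hb0.ne'] using h4

theorem axisDistSq_of_frame {u k e m : E3} {b l : ℝ} (hk : ‖k‖ = 1) (he : ‖e‖ = 1)
    (hku : ⟪k, u⟫ = 0) (hke : ⟪k, e⟫ = 0) :
    axisDistSq (m + b • k) u (m + l • e) = b ^ 2 + l ^ 2 * (1 - ⟪e, u⟫ ^ 2) := by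
  rw [axisDistSq, add_sub_add_left_eq_sub, norm_sub_sq_real, inner_sub_left, norm_smul, norm_smul,
    hk, he, inner_smul_left, inner_smul_left, inner_smul_left, inner_smul_right,
    real_inner_comm, hke, hku]
  simp
  ring

-- The axis turns about the common normal `k` of the axis and the line `pq`, towards the direction
-- `e` of that line. While the sine `S` of their angle decreases to `0`, the distance `√(r² - a²
-- S²)` from the midpoint `m` keeps `p` and `q` on the surface. The point `m + l • e` then has
-- squared distance `r² + (l² - a²) S²` from the axis, so the segment from `p` to `q` stays
-- enclosed. If nothing is hit, the axis becomes parallel to `pq` and `exists_axisMoves_touch_two`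
-- applies.
set_option maxHeartbeats 1000000 in
theorem exists_axisMoves_touch_three {P : Finset E3} {r : ℝ} (hr : 0 < r) {o u p q s₀ : E3}
    (hu : ‖u‖ = 1) (h : ∀ x ∈ P, axisDistSq o u x ≤ r ^ 2) (hp : axisDistSq o u p = r ^ 2)
    (hq : axisDistSq o u q = r ^ 2) (hpq : ¬ ∃ c : ℝ, q = p + c • u) (hs₀ : s₀ ∈ P)
    (hs₀' : ¬ ∃ c : ℝ, s₀ = p + c • (q - p)) :
    ∃ o' u', AxisMoves P r o u o' u' ∧ axisDistSq o' u' p = r ^ 2 ∧ axisDistSq o' u' q = r ^ 2 ∧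
      ∃ s ∈ P, axisDistSq o' u' s = r ^ 2 ∧ ¬ ∃ c : ℝ, s = p + c • (q - p) := by
  have hqp : q - p ≠ 0 := by
    intro h0
    exact hpq ⟨0, by simpa [sub_eq_zero] using h0⟩
  have hd : ‖q - p‖ ≠ 0 := by simpa using hqp
  -- a unit vector along the line, pointing to the side of `u`
  obtain ⟨e, a, he, ha, hea, hc0⟩ : ∃ (e : E3) (a : ℝ), ‖e‖ = 1 ∧ a ≠ 0 ∧ q - p = (2 * a) • e ∧
      0 ≤ ⟪e, u⟫ := by
    rcases le_total 0 ⟪q - p, u⟫ with hs | hs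
    · refine ⟨‖q - p‖⁻¹ • (q - p), ‖q - p‖ / 2, by simp [norm_smul, hd], by positivity, ?_, ?_⟩
      · rw [smul_smul, mul_div_cancel₀ _ two_ne_zero, mul_inv_cancel₀ hd, one_smul]
      · rw [inner_smul_left]; exact mul_nonneg (by simp) hs
    · refine ⟨-‖q - p‖⁻¹ • (q - p), -‖q - p‖ / 2, by simp [norm_smul, hd],
        by simpa using hqp, ?_, ?_⟩
      · rw [smul_smul, mul_div_cancel₀ _ two_ne_zero, neg_mul_neg, mul_inv_cancel₀ hd, one_smul]
      · rw [inner_smul_left]; exact mul_nonneg_of_nonpos_of_nonpos (by simp) hs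
  set m := p + a • e with hm
  have hpm : p = m - a • e := by rw [hm]; abel
  have hqm : q = m + a • e := by
    rw [hm, eq_add_of_sub_eq hea]; module
  obtain ⟨k, b, c, hk, hku, hke, hb, hmo⟩ := exists_common_normal (m := m) (e := e) hu ha
    (by rw [← hpm, ← hqm, hp, hq])
  set c₀ := ⟪e, u⟫ with hc₀
  have hne : u - c₀ • e ≠ 0 := by
    intro h0
    rw [sub_eq_zero] at h0
    have hc0' : c₀ ≠ 0 := by
      intro h1
      rw [h1, zero_smul] at h0
      simp [h0] at hu
    apply hpq
    refine ⟨2 * a * c₀⁻¹, ?_⟩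
    have h3 : (2 * a * c₀⁻¹) • u = (2 * a * c₀⁻¹) • c₀ • e := congrArg _ h0
    rw [h3, smul_smul, mul_assoc, inv_mul_cancel₀ hc0', mul_one, ← hea]
    abel
  have hns : ‖u - c₀ • e‖ ^ 2 = 1 - c₀ ^ 2 := by
    rw [norm_sub_sq_real, inner_smul_right, real_inner_comm, ← hc₀, norm_smul, he, hu]
    simp
    ring
  set s := ‖u - c₀ • e‖ with hs
  have hspos : 0 < s := by simpa [hs] using hne
  set M := s⁻¹ • (u - c₀ • e) with hM
  have hM1 : ‖M‖ = 1 := by rw [hM, norm_smul, ← hs, norm_inv, Real.norm_of_nonneg hspos.le, inv_mul_cancel₀ hspos.ne']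
  have heM : ⟪e, M⟫ = 0 := by
    rw [hM, inner_smul_right, inner_sub_right, inner_smul_right, ← hc₀,
      real_inner_self_eq_norm_sq, he]
    simp
  have hkM : ⟪k, M⟫ = 0 := by
    rw [hM, inner_smul_right, inner_sub_right, inner_smul_right, hku, hke]
    simp
  have hueq : u = c₀ • e + s • M := by
    rw [hM, smul_smul, mul_inv_cancel₀ hspos.ne', one_smul]; abel
  let S : unitInterval → ℝ := fun t => (1 - t) * s
  let v : unitInterval → E3 := fun t => Real.sqrt (1 - S t ^ 2) • e + S t • M
  let w : unitInterval → E3 := fun t => m + Real.sqrt (r ^ 2 - a ^ 2 * S t ^ 2) • k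
  have hSle : ∀ t, S t ^ 2 ≤ s ^ 2 := by
    intro t
    have h1 := t.2.1
    have h2 := t.2.2
    exact pow_le_pow_left₀ (mul_nonneg (by linarith) hspos.le) (by nlinarith) 2
  have hS1 : ∀ t, 0 ≤ 1 - S t ^ 2 := fun t => by nlinarith [hSle t, sq_nonneg c₀]
  have hline : ∀ l : ℝ, axisDistSq o u (m + l • e) = b ^ 2 + l ^ 2 * s ^ 2 := by
    intro l
    rw [← axisDistSq_origin_add_smul hu o _ c, ← hmo, axisDistSq_of_frame hk he hku hke, ← hc₀, hns]
  have hbr : b ^ 2 = r ^ 2 - a ^ 2 * s ^ 2 := by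
    rw [← hq, hqm, hline]; ring
  have hSr : ∀ t, 0 ≤ r ^ 2 - a ^ 2 * S t ^ 2 := fun t => by
    nlinarith [mul_le_mul_of_nonneg_left (hSle t) (sq_nonneg a), sq_nonneg b]
  have hev : ∀ t, ⟪e, v t⟫ = Real.sqrt (1 - S t ^ 2) := by
    intro t
    simp [v, inner_add_right, inner_smul_right, heM, he]
  have hkv : ∀ t, ⟪k, v t⟫ = 0 := by
    intro t
    simp [v, inner_add_right, inner_smul_right, hkM, hke]
  have hv1 : ∀ t, ‖v t‖ = 1 := by
    intro t
    have : ‖v t‖ ^ 2 = 1 := by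
      simp only [v]
      rw [norm_add_sq_real, norm_smul, norm_smul, inner_smul_left, inner_smul_right, heM, he, hM1]
      simp [Real.sq_sqrt (hS1 t)]
    nlinarith [norm_nonneg (v t)]
  have hlinet : ∀ (t) (l : ℝ), axisDistSq (w t) (v t) (m + l • e) =
      r ^ 2 + (l ^ 2 - a ^ 2) * S t ^ 2 := by
    intro t l
    rw [axisDistSq_of_frame hk he (hkv t) hke, hev, Real.sq_sqrt (hS1 t), Real.sq_sqrt (hSr t)]
    ring
  have hv0 : v 0 = u := by
    have : Real.sqrt (1 - s ^ 2) = c₀ := by rw [hns, sub_sub_cancel, Real.sqrt_sq hc0]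
    simp [v, S, this, ← hueq]
  have hw0 : w 0 = o + c • u := by
    have : Real.sqrt (r ^ 2 - a ^ 2 * s ^ 2) = b := by rw [← hbr, Real.sqrt_sq hb]
    simp [w, S, this, ← hmo]
  have hvc : Continuous v := by fun_prop
  have hwc : Continuous w := by fun_prop
  obtain ⟨t, ht, hend⟩ := exists_motion_until_hit (P := P) hr (fun x => ¬ ∃ c : ℝ, x = p + c • (q - p))
    (o := w) (u := v) (k := fun _ => k) hwc hvc continuous_const hv1 (fun _ => hk) hkv
    (by simp only [hv0, hw0, axisDistSq_origin_add_smul hu]; exact h)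
    (by
      intro x hxP hx t
      obtain ⟨d, hd⟩ := not_not.1 hx
      have hxe : x = m + (2 * a * d - a) • e := by
        rw [hd, hea, hpm]; module
      have h1 := h x hxP
      rw [hxe, hline, hbr] at h1
      rw [hxe, hlinet]
      -- Enclosure at the start, where the sine `s` is positive, forces a point of `P` on the line
      -- `pq` to lie between `p` and `q`.
      have h2 : (2 * a * d - a) ^ 2 - a ^ 2 ≤ 0 := by
        by_contra hcon
        nlinarith [mul_pos (not_le.1 hcon) (pow_pos hspos 2)]
      nlinarith [mul_nonneg (neg_nonneg.2 h2) (sq_nonneg (S t))])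
  rw [hv0, hw0, AxisMoves, axisLine_add_smul, ← AxisMoves] at ht
  have hpt : axisDistSq (w t) (v t) p = r ^ 2 := by
    rw [show p = m + (-a) • e by rw [hpm]; module, hlinet]; ring
  have hqt : axisDistSq (w t) (v t) q = r ^ 2 := by
    rw [hqm, hlinet]; ring
  rcases hend with rfl | ⟨x, hx, hxp, hxe⟩
  · have hve : v 1 = e := by simp [v, S]
    have hiff : ∀ x, (∃ c : ℝ, x = p + c • v 1) → ∃ c : ℝ, x = p + c • (q - p) := by
      rintro x ⟨c, rfl⟩
      refine ⟨c / (2 * a), ?_⟩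
      rw [hve, hea, smul_smul, div_mul_cancel₀ _ (by simpa using ha)]
    obtain ⟨o', ho', hpo', x, hx, hxe, hxp⟩ := exists_axisMoves_touch_two hr (hv1 1) ht.2.1 hpt hs₀
      (fun hcon => hs₀' (hiff _ hcon))
    refine ⟨o', v 1, ht.trans ho', hpo', ?_, x, hx, hxe, ?_⟩
    · rw [show q = p + (2 * a) • v 1 by rw [hve, ← hea]; abel, axisDistSq_add_smul (hv1 1), hpo']
    · rintro ⟨c, rfl⟩
      exact hxp ⟨c * (2 * a), by rw [hve, hea, smul_smul]⟩
  · exact ⟨_, _, ht, hpt, hqt, x, hx, hxe, hxp⟩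

/-! ### Zero sets of continuous families of strictly convex functions. -/

/-- The point `e` is the right end of the component of `a` in `V`, found as the infimum of the
points of `[a, b]` outside `V`. -/
theorem exists_right_end {V : Set ℝ} (hV : IsClosed V) {a b : ℝ} (ha : a ∈ V)
    (h : ¬ Set.Icc a b ⊆ V) :
    ∃ e, a ≤ e ∧ e < b ∧ Set.Icc a e ⊆ V ∧ ∀ δ > 0, ∃ w, e < w ∧ w < e + δ ∧ w < b ∧ w ∉ V := by
  set W : Set ℝ := Set.Icc a b \ V with hW
  have hne : W.Nonempty := by
    obtain ⟨x, hx, hxV⟩ := Set.not_subset.1 h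
    exact ⟨x, hx, hxV⟩
  have hbdd : BddBelow W := ⟨a, fun x hx => hx.1.1⟩
  have hae : a ≤ sInf W := le_csInf hne fun x hx => hx.1.1
  have hlt : ∀ x, a ≤ x → x < sInf W → x ∈ V := by
    intro x hax hx
    by_contra hxV
    obtain ⟨w, hw⟩ := hne
    have : x ∈ W := ⟨⟨hax, hx.le.trans ((csInf_le hbdd hw).trans hw.1.2)⟩, hxV⟩
    exact absurd (csInf_le hbdd this) (not_le.2 hx)
  have heV : sInf W ∈ V := by
    rcases hae.eq_or_lt with h' | h'
    · rw [← h']; exact ha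
    · have h1 : sInf W ∈ closure (Set.Ico a (sInf W)) := by
        rw [closure_Ico h'.ne]; exact ⟨hae, le_rfl⟩
      exact closure_minimal (fun x hx => hlt x hx.1 hx.2) hV h1
  have heb : sInf W < b := by
    obtain ⟨w, hw⟩ := hne
    refine lt_of_le_of_ne ((csInf_le hbdd hw).trans hw.1.2) fun heq => ?_
    have : w = b := le_antisymm hw.1.2 (heq ▸ csInf_le hbdd hw)
    exact hw.2 (by rw [this, ← heq]; exact heV)
  refine ⟨sInf W, hae, heb, fun x hx => ?_, fun δ hδ => ?_⟩
  · rcases hx.2.eq_or_lt with h' | h'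
    · rw [h']; exact heV
    · exact hlt x hx.1 h'
  · obtain ⟨w, hw, hwlt⟩ := exists_lt_of_csInf_lt hne
      (show sInf W < min (sInf W + δ) b from lt_min (by linarith) heb)
    refine ⟨w, lt_of_le_of_ne (csInf_le hbdd hw) ?_, hwlt.trans_le (min_le_left _ _),
      hwlt.trans_le (min_le_right _ _), hw.2⟩
    rintro heq
    exact hw.2 (heq ▸ heV)

theorem exists_left_end {V : Set ℝ} (hV : IsClosed V) {a b : ℝ} (hb : b ∈ V)
    (h : ¬ Set.Icc a b ⊆ V) :
    ∃ e, e ≤ b ∧ a < e ∧ Set.Icc e b ⊆ V ∧ ∀ δ > 0, ∃ w, w < e ∧ e - δ < w ∧ a < w ∧ w ∉ V := by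
  obtain ⟨e, h1, h2, h3, h4⟩ := exists_right_end (V := (fun x => -x) ⁻¹' V) (a := -b) (b := -a)
    (hV.preimage continuous_neg) (by simpa using hb) (by
      intro hsub
      refine h fun x hx => ?_
      simpa using @hsub (-x) ⟨by linarith [hx.2], by linarith [hx.1]⟩)
  refine ⟨-e, by linarith, by linarith, fun x hx => ?_, fun δ hδ => ?_⟩
  · simpa using @h3 (-x) ⟨by linarith [hx.2], by linarith [hx.1]⟩
  · obtain ⟨w, w1, w2, w3, w4⟩ := h4 δ hδ
    exact ⟨-w, by linarith, by linarith, by linarith, w4⟩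

theorem joinedIn_graph {Z : Set (ℝ × ℝ)} {f : ℝ → ℝ} {a b x y : ℝ}
    (hf : ContinuousOn f (Set.Icc a b)) (hZ : ∀ t ∈ Set.Icc a b, (t, f t) ∈ Z)
    (hx : x ∈ Set.Icc a b) (hy : y ∈ Set.Icc a b) : JoinedIn Z (x, f x) (y, f y) := by
  have h1 : IsPathConnected ((fun t => (t, f t)) '' Set.Icc a b) :=
    ((convex_Icc a b).isPathConnected ⟨x, hx⟩).image' (continuousOn_id.prodMk hf)
  refine (h1.joinedIn _ ⟨x, hx, rfl⟩ _ ⟨y, hy, rfl⟩).mono ?_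
  rintro _ ⟨t, ht, rfl⟩
  exact hZ t ht

section Roots

variable (h : ℝ → ℝ → ℝ)

/-- The parameters in the unit interval at which `h x` is not positive. -/
def nonposSet (x : ℝ) : Set ℝ := {s ∈ Set.Icc (0 : ℝ) 1 | h x s ≤ 0}

/-- The points of the unit interval at which `h x` takes a nonpositive value. -/
def nonposDomain : Set ℝ := {x ∈ Set.Icc (0 : ℝ) 1 | (nonposSet h x).Nonempty}

variable {h}

theorem isCompact_nonposSet (hc : Continuous (Function.uncurry h)) (x : ℝ) :
    IsCompact (nonposSet h x) := by
  refine isCompact_Icc.inter_right (t := {s | h x s ≤ 0}) ?_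
  exact isClosed_le (hc.comp (Continuous.prodMk_right x)) continuous_const

theorem isClosed_exists_nonpos (hc : Continuous (Function.uncurry h)) (c d : ℝ) :
    IsClosed {x ∈ Set.Icc (0 : ℝ) 1 | ∃ s ∈ Set.Icc c d, h x s ≤ 0} := by
  have h1 : IsCompact ((Set.Icc (0 : ℝ) 1 ×ˢ Set.Icc c d) ∩ {z | Function.uncurry h z ≤ 0}) :=
    (isCompact_Icc.prod isCompact_Icc).inter_right (isClosed_le hc continuous_const)
  convert (h1.image continuous_fst).isClosed using 1
  ext x
  constructor
  · rintro ⟨hx, s, hs, hle⟩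
    exact ⟨(x, s), ⟨⟨hx, hs⟩, hle⟩, rfl⟩
  · rintro ⟨⟨y, s⟩, ⟨⟨hx, hs⟩, hle⟩, rfl⟩
    exact ⟨hx, s, hs, hle⟩

theorem isClosed_nonposDomain (hc : Continuous (Function.uncurry h)) :
    IsClosed (nonposDomain h) :=
  isClosed_exists_nonpos hc 0 1

theorem sSup_mem_nonposSet (hc : Continuous (Function.uncurry h)) {x : ℝ}
    (hx : x ∈ nonposDomain h) : sSup (nonposSet h x) ∈ nonposSet h x :=
  (isCompact_nonposSet hc x).sSup_mem hx.2

theorem sInf_mem_nonposSet (hc : Continuous (Function.uncurry h)) {x : ℝ}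
    (hx : x ∈ nonposDomain h) : sInf (nonposSet h x) ∈ nonposSet h x :=
  (isCompact_nonposSet hc x).sInf_mem hx.2

theorem le_sSup_nonposSet {x s : ℝ} (hs : s ∈ nonposSet h x) : s ≤ sSup (nonposSet h x) :=
  le_csSup ⟨1, fun _ h => h.1.2⟩ hs

theorem sInf_nonposSet_le {x s : ℝ} (hs : s ∈ nonposSet h x) : sInf (nonposSet h x) ≤ s :=
  csInf_le ⟨0, fun _ h => h.1.1⟩ hs

theorem neg_of_between {x s a b : ℝ} (hconv : StrictConvexOn ℝ (Set.Icc 0 1) (h x))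
    (ha : a ∈ nonposSet h x) (hb : b ∈ nonposSet h x) (has : a < s) (hsb : s < b) : h x s < 0 := by
  have h1 := hconv.lt_on_openSegment ha.1 hb.1 (has.trans hsb).ne
    (z := s) (by rw [openSegment_eq_Ioo (has.trans hsb)]; exact ⟨has, hsb⟩)
  exact h1.trans_le (max_le ha.2 hb.2)

theorem eventually_lt_of_closed {c d : ℝ} (hc : Continuous (Function.uncurry h)) {x : ℝ}
    (hno : ¬ ∃ s ∈ Set.Icc c d, h x s ≤ 0) :
    ∀ᶠ y in nhdsWithin x (nonposDomain h), ¬ ∃ s ∈ Set.Icc c d, h y s ≤ 0 := by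
  have h1 : ∀ᶠ y in nhds x, y ∉ {x ∈ Set.Icc (0 : ℝ) 1 | ∃ s ∈ Set.Icc c d, h x s ≤ 0} :=
    (isClosed_exists_nonpos hc c d).isOpen_compl.mem_nhds fun hx => hno hx.2
  filter_upwards [nhdsWithin_le_nhds h1, self_mem_nhdsWithin] with y hy hyV hcon
  exact hy ⟨hyV.1, hcon⟩

theorem eventually_lt_sInf (hc : Continuous (Function.uncurry h)) {x c : ℝ}
    (hlt : c < sInf (nonposSet h x)) :
    ∀ᶠ y in nhdsWithin x (nonposDomain h), c < sInf (nonposSet h y) := by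
  have hno : ¬ ∃ s ∈ Set.Icc 0 (min c 1), h x s ≤ 0 := by
    rintro ⟨s, hs, hle⟩
    have := sInf_nonposSet_le (h := h) (x := x) ⟨⟨hs.1, hs.2.trans (min_le_right _ _)⟩, hle⟩
    exact absurd (this.trans (hs.2.trans (min_le_left _ _))) (not_le.2 hlt)
  filter_upwards [eventually_lt_of_closed hc hno, self_mem_nhdsWithin] with y hy hyV
  have hm := sInf_mem_nonposSet hc hyV
  by_contra hcon
  exact hy ⟨_, ⟨hm.1.1, le_min (not_lt.1 hcon) hm.1.2⟩, hm.2⟩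

theorem eventually_sSup_lt (hc : Continuous (Function.uncurry h)) {x c : ℝ}
    (hlt : sSup (nonposSet h x) < c) :
    ∀ᶠ y in nhdsWithin x (nonposDomain h), sSup (nonposSet h y) < c := by
  have hno : ¬ ∃ s ∈ Set.Icc (max c 0) 1, h x s ≤ 0 := by
    rintro ⟨s, hs, hle⟩
    have := le_sSup_nonposSet (h := h) (x := x) ⟨⟨(le_max_right _ _).trans hs.1, hs.2⟩, hle⟩
    exact absurd (((le_max_left _ _).trans hs.1).trans this) (not_le.2 hlt)
  filter_upwards [eventually_lt_of_closed hc hno, self_mem_nhdsWithin] with y hy hyV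
  have hm := sSup_mem_nonposSet hc hyV
  by_contra hcon
  exact hy ⟨_, ⟨max_le (not_lt.1 hcon) hm.1.1, hm.1.2⟩, hm.2⟩

theorem eventually_mem_nonposSet (hc : Continuous (Function.uncurry h)) {x s : ℝ}
    (hs : s ∈ Set.Icc (0 : ℝ) 1) (hneg : h x s < 0) :
    ∀ᶠ y in nhdsWithin x (nonposDomain h), s ∈ nonposSet h y := by
  have hc' : Continuous fun y => h y s := hc.comp (Continuous.prodMk_left s)
  filter_upwards [nhdsWithin_le_nhds (hc'.tendsto x |>.eventually_lt_const hneg)] with y hy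
  exact ⟨hs, hy.le⟩

/-- Upper semicontinuity is compactness. For lower semicontinuity, a nondegenerate interval contains
points near its upper end where `h x` is strictly negative, and these persist for nearby parameters;
a degenerate interval is controlled from below by its infimum. -/
theorem continuousOn_sSup_nonposSet (hc : Continuous (Function.uncurry h))
    (hconv : ∀ x ∈ Set.Icc (0 : ℝ) 1, StrictConvexOn ℝ (Set.Icc 0 1) (h x)) :
    ContinuousOn (fun x => sSup (nonposSet h x)) (nonposDomain h) := by
  intro x hx
  refine tendsto_order.2 ⟨fun c hlt => ?_, fun c hlt => eventually_sSup_lt hc hlt⟩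
  have h1 := sInf_mem_nonposSet hc hx
  have h2 := sSup_mem_nonposSet hc hx
  rcases (sInf_nonposSet_le h2).eq_or_lt with heq | hne
  · filter_upwards [eventually_lt_sInf hc (hlt.trans_eq heq.symm), self_mem_nhdsWithin] with y hy hyV
    exact hy.trans_le (sInf_nonposSet_le (sSup_mem_nonposSet hc hyV))
  · obtain ⟨s, hs1, hs2⟩ := exists_between (max_lt hne hlt)
    have hs0 : sInf (nonposSet h x) < s := (le_max_left _ _).trans_lt hs1
    filter_upwards [eventually_mem_nonposSet hc
      ⟨h1.1.1.trans hs0.le, hs2.le.trans h2.1.2⟩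
      (neg_of_between (hconv x hx.1) h1 h2 hs0 hs2)] with y hy
    exact ((le_max_right _ _).trans_lt hs1).trans_le (le_sSup_nonposSet hy)

theorem continuousOn_sInf_nonposSet (hc : Continuous (Function.uncurry h))
    (hconv : ∀ x ∈ Set.Icc (0 : ℝ) 1, StrictConvexOn ℝ (Set.Icc 0 1) (h x)) :
    ContinuousOn (fun x => sInf (nonposSet h x)) (nonposDomain h) := by
  intro x hx
  refine tendsto_order.2 ⟨fun c hlt => eventually_lt_sInf hc hlt, fun c hlt => ?_⟩
  have h1 := sInf_mem_nonposSet hc hx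
  have h2 := sSup_mem_nonposSet hc hx
  rcases (sInf_nonposSet_le h2).eq_or_lt with heq | hne
  · filter_upwards [eventually_sSup_lt hc (heq.symm.trans_lt hlt), self_mem_nhdsWithin] with y hy hyV
    exact (sInf_nonposSet_le (sSup_mem_nonposSet hc hyV)).trans_lt hy
  · obtain ⟨s, hs1, hs2⟩ := exists_between (lt_min hne hlt)
    have hs0 : s < sSup (nonposSet h x) := hs2.trans_le (min_le_left _ _)
    filter_upwards [eventually_mem_nonposSet hc
      ⟨h1.1.1.trans hs1.le, hs0.le.trans h2.1.2⟩
      (neg_of_between (hconv x hx.1) h1 h2 hs1 hs0)] with y hy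
    exact (sInf_nonposSet_le hy).trans_lt (hs2.trans_le (min_le_right _ _))

theorem eq_zero_sSup_nonposSet (hc : Continuous (Function.uncurry h)) {x : ℝ}
    (hx : x ∈ nonposDomain h) (h1 : 0 ≤ h x 1) : h x (sSup (nonposSet h x)) = 0 := by
  have hm := sSup_mem_nonposSet hc hx
  refine le_antisymm hm.2 (not_lt.1 fun hneg => ?_)
  obtain ⟨s, hs, hs0⟩ := intermediate_value_Icc hm.1.2
    (hc.comp (Continuous.prodMk_right x)).continuousOn ⟨hneg.le, h1⟩
  have h2 := le_sSup_nonposSet (h := h) (x := x) ⟨⟨hm.1.1.trans hs.1, hs.2⟩, hs0.le⟩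
  rw [le_antisymm h2 hs.1] at hs0
  exact hneg.ne hs0

theorem eq_zero_sInf_nonposSet (hc : Continuous (Function.uncurry h)) {x : ℝ}
    (hx : x ∈ nonposDomain h) (h0 : 0 ≤ h x 0) : h x (sInf (nonposSet h x)) = 0 := by
  have hm := sInf_mem_nonposSet hc hx
  refine le_antisymm hm.2 (not_lt.1 fun hneg => ?_)
  obtain ⟨s, hs, hs0⟩ := intermediate_value_Icc' hm.1.1
    (hc.comp (Continuous.prodMk_right x)).continuousOn ⟨hneg.le, h0⟩
  have h2 := sInf_nonposSet_le (h := h) (x := x) ⟨⟨hs.1, hs.2.trans hm.1.2⟩, hs0.le⟩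
  rw [le_antisymm hs.2 h2] at hs0
  exact hneg.ne hs0

/-- An interval of positive length has an inner point with a strictly negative value, which would
keep all nearby parameters in the domain. -/
theorem sInf_eq_sSup_of_accumulation (hc : Continuous (Function.uncurry h)) {x : ℝ}
    (hx : x ∈ nonposDomain h) (hconv : StrictConvexOn ℝ (Set.Icc 0 1) (h x))
    (hacc : ∀ U ∈ nhds x, ∃ y ∈ U, y ∈ Set.Icc (0 : ℝ) 1 ∧ y ∉ nonposDomain h) :
    sInf (nonposSet h x) = sSup (nonposSet h x) := by
  have h1 := sInf_mem_nonposSet hc hx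
  have h2 := sSup_mem_nonposSet hc hx
  rcases (sInf_nonposSet_le h2).eq_or_lt with heq | hne
  · exact heq
  · exfalso
    obtain ⟨s, hs1, hs2⟩ := exists_between hne
    have hc' : Continuous fun y => h y s := hc.comp (Continuous.prodMk_left s)
    obtain ⟨y, hy, hy01, hyV⟩ := hacc _ (hc'.tendsto x |>.eventually_lt_const
      (neg_of_between hconv h1 h2 hs1 hs2))
    exact hyV ⟨hy01, s, ⟨h1.1.1.trans hs1.le, hs2.le.trans h2.1.2⟩, hy.le⟩

/-- A zero of a family of strictly convex functions on the unit interval that is nonnegative at the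
right end and does not enclose a nonpositive region can be joined in the zero set to the left, the
right, or the upper side of the unit square. -/
theorem exists_joinedIn_zeros (hc : Continuous (Function.uncurry h))
    (hconv : ∀ x ∈ Set.Icc (0 : ℝ) 1, StrictConvexOn ℝ (Set.Icc 0 1) (h x))
    (h1 : ∀ x ∈ Set.Icc (0 : ℝ) 1, 0 ≤ h x 1)
    (h0 : (∀ x ∈ Set.Icc (0 : ℝ) 1, 0 < h x 0) ∨ ∀ x ∈ Set.Icc (0 : ℝ) 1, h x 0 ≤ 0)
    (hrect : ∀ a b, 0 < a → b < 1 → (∀ s ∈ Set.Icc (0 : ℝ) 1, 0 < h a s) →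
      (∀ s ∈ Set.Icc (0 : ℝ) 1, 0 < h b s) → (∀ x ∈ Set.Icc a b, 0 < h x 0) →
      (∀ x ∈ Set.Icc a b, 0 < h x 1) → ∀ x ∈ Set.Icc a b, ∀ s ∈ Set.Icc (0 : ℝ) 1, 0 < h x s)
    {x₀ s₀ : ℝ} (hx₀ : x₀ ∈ Set.Icc (0 : ℝ) 1) (hs₀ : 0 < s₀) (hs₁ : s₀ ≤ 1) (hz : h x₀ s₀ = 0) :
    ∃ x s, (x = 0 ∨ x = 1 ∨ s = 1) ∧
      JoinedIn {z : ℝ × ℝ | z.1 ∈ Set.Icc (0 : ℝ) 1 ∧ z.2 ∈ Set.Icc (0 : ℝ) 1 ∧ h z.1 z.2 = 0}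
        (x₀, s₀) (x, s) := by
  set Z := {z : ℝ × ℝ | z.1 ∈ Set.Icc (0 : ℝ) 1 ∧ z.2 ∈ Set.Icc (0 : ℝ) 1 ∧ h z.1 z.2 = 0}
  set V := nonposDomain h with hVdef
  have hVc : IsClosed V := isClosed_nonposDomain hc
  have hs₀A : s₀ ∈ nonposSet h x₀ := ⟨⟨hs₀.le, hs₁⟩, hz.le⟩
  have hx₀V : x₀ ∈ V := ⟨hx₀, s₀, hs₀A⟩
  let f : ℝ → ℝ := fun x => sSup (nonposSet h x)
  let g : ℝ → ℝ := fun x => sInf (nonposSet h x)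
  have hf : ContinuousOn f V := continuousOn_sSup_nonposSet hc hconv
  have hg : ContinuousOn g V := continuousOn_sInf_nonposSet hc hconv
  have hfZ : ∀ x ∈ V, (x, f x) ∈ Z := fun x hx =>
    ⟨hx.1, (sSup_mem_nonposSet hc hx).1, eq_zero_sSup_nonposSet hc hx (h1 x hx.1)⟩
  have joinf : ∀ {a b x y}, Set.Icc a b ⊆ V → x ∈ Set.Icc a b → y ∈ Set.Icc a b →
      JoinedIn Z (x, f x) (y, f y) := fun hsub hx hy =>
    joinedIn_graph (hf.mono hsub) (fun t ht => hfZ t (hsub ht)) hx hy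
  have hbetween : g x₀ < s₀ → s₀ < f x₀ → False := fun hlt hgt =>
    (neg_of_between (hconv x₀ hx₀) (sInf_mem_nonposSet hc hx₀V) (sSup_mem_nonposSet hc hx₀V)
      hlt hgt).ne hz
  rcases h0 with h0 | h0
  · have hgZ : ∀ x ∈ V, (x, g x) ∈ Z := fun x hx =>
      ⟨hx.1, (sInf_mem_nonposSet hc hx).1, eq_zero_sInf_nonposSet hc hx (h0 x hx.1).le⟩
    have joing : ∀ {a b x y}, Set.Icc a b ⊆ V → x ∈ Set.Icc a b → y ∈ Set.Icc a b →
        JoinedIn Z (x, g x) (y, g y) := fun hsub hx hy =>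
      joinedIn_graph (hg.mono hsub) (fun t ht => hgZ t (hsub ht)) hx hy
    -- Strictly between the two ends `h x₀` is negative, so a zero is one of the ends.
    have hs₀fg : s₀ = f x₀ ∨ s₀ = g x₀ := by
      by_contra! hcon
      exact hbetween (lt_of_le_of_ne (sInf_nonposSet_le hs₀A) hcon.2.symm)
        (lt_of_le_of_ne (le_sSup_nonposSet hs₀A) hcon.1)
    by_cases hR : Set.Icc x₀ 1 ⊆ V
    · have hm1 : x₀ ∈ Set.Icc x₀ 1 := ⟨le_rfl, hx₀.2⟩
      have hm2 : (1 : ℝ) ∈ Set.Icc x₀ 1 := ⟨hx₀.2, le_rfl⟩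
      rcases hs₀fg with e | e
      · exact ⟨1, f 1, by simp, by rw [e]; exact joinf hR hm1 hm2⟩
      · exact ⟨1, g 1, by simp, by rw [e]; exact joing hR hm1 hm2⟩
    by_cases hL : Set.Icc 0 x₀ ⊆ V
    · have hm1 : x₀ ∈ Set.Icc 0 x₀ := ⟨hx₀.1, le_rfl⟩
      have hm2 : (0 : ℝ) ∈ Set.Icc 0 x₀ := ⟨le_rfl, hx₀.1⟩
      rcases hs₀fg with e | e
      · exact ⟨0, f 0, by simp, by rw [e]; exact joinf hL hm1 hm2⟩
      · exact ⟨0, g 0, by simp, by rw [e]; exact joing hL hm1 hm2⟩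
    obtain ⟨b, hxb, hb1, hbV, hbacc⟩ := exists_right_end hVc hx₀V hR
    obtain ⟨a, hax, ha0, haV, haacc⟩ := exists_left_end hVc hx₀V hL
    have hab : Set.Icc a b ⊆ V := by
      intro x hx
      rcases le_total x x₀ with hle | hle
      · exact haV ⟨hx.1, hle⟩
      · exact hbV ⟨hle, hx.2⟩
    have hbb : b ∈ Set.Icc x₀ b := ⟨hxb, le_rfl⟩
    -- The lower and upper branches meet at `b`, where a path can change from one to the other.
    have hgf : g b = f b := by
      refine sInf_eq_sSup_of_accumulation hc (hbV hbb) (hconv b (hbV hbb).1) fun U hU => ?_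
      obtain ⟨δ, hδ, hsub⟩ := Metric.mem_nhds_iff.1 hU
      obtain ⟨w, w1, w2, w3, w4⟩ := hbacc δ hδ
      refine ⟨w, hsub ?_, ⟨hx₀.1.trans (hxb.trans w1.le), w3.le⟩, w4⟩
      rw [Metric.mem_ball, Real.dist_eq, abs_of_pos (by linarith)]
      linarith
    have hjb : JoinedIn Z (x₀, s₀) (b, f b) := by
      rcases hs₀fg with e | e
      · rw [e]; exact joinf hbV ⟨le_rfl, hxb⟩ hbb
      · rw [e, ← hgf]; exact joing hbV ⟨le_rfl, hxb⟩ hbb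
    by_cases hex : ∃ x ∈ Set.Icc a b, h x 1 = 0
    · obtain ⟨x, hx, hx1⟩ := hex
      have hf1 : f x = 1 := le_antisymm (sSup_mem_nonposSet hc (hab hx)).1.2
        (le_sSup_nonposSet ⟨⟨zero_le_one, le_rfl⟩, hx1.le⟩)
      refine ⟨x, 1, by simp, ?_⟩
      rw [← hf1]
      exact hjb.trans (joinf hab ⟨hax.trans hxb, le_rfl⟩ hx)
    · exfalso
      push Not at hex
      have hpos : ∀ x ∈ Set.Icc a b, 0 < h x 1 := fun x hx =>
        lt_of_le_of_ne (h1 x (hab hx).1) (hex x hx).symm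
      -- If the upper branch never reaches height `1` over `[a, b]`, parameters `v` and `w` just
      -- outside bound a rectangle with positive values on all four sides, contrary to `hrect`.
      have hc1 : Continuous fun y => h y 1 := hc.comp (Continuous.prodMk_left 1)
      obtain ⟨δ, hδ, hball⟩ := Metric.mem_nhds_iff.1
        (hc1.tendsto b |>.eventually_const_lt (hpos b ⟨hax.trans hxb, le_rfl⟩))
      obtain ⟨δ', hδ', hball'⟩ := Metric.mem_nhds_iff.1
        (hc1.tendsto a |>.eventually_const_lt (hpos a ⟨le_rfl, hax.trans hxb⟩))
      obtain ⟨w, w1, w2, w3, w4⟩ := hbacc δ hδ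
      obtain ⟨v, v1, v2, v3, v4⟩ := haacc δ' hδ'
      have hout : ∀ y ∈ Set.Icc (0 : ℝ) 1, y ∉ V → ∀ s ∈ Set.Icc (0 : ℝ) 1, 0 < h y s := by
        intro y hy hyV s hs
        by_contra hcon
        exact hyV ⟨hy, s, hs, not_lt.1 hcon⟩
      have hvw : ∀ x ∈ Set.Icc v w, x ∈ Set.Icc (0 : ℝ) 1 := fun x hx =>
        ⟨v3.le.trans hx.1, hx.2.trans w3.le⟩
      have := hrect v w v3 w3 (hout v ⟨v3.le, by linarith [hx₀.2]⟩ v4)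
        (hout w ⟨by linarith [hx₀.1], w3.le⟩ w4) (fun x hx => h0 x (hvw x hx))
        (by
          intro x hx
          rcases lt_or_ge x a with hxa | hxa
          · refine hball' ?_
            rw [Metric.mem_ball, Real.dist_eq, abs_sub_comm, abs_of_pos (by linarith)]
            linarith [hx.1]
          rcases lt_or_ge b x with hbx | hbx
          · refine hball ?_
            rw [Metric.mem_ball, Real.dist_eq, abs_of_pos (by linarith)]
            linarith [hx.2]
          · exact hpos x ⟨hxa, hbx⟩)
        x₀ ⟨by linarith, by linarith⟩ s₀ ⟨hs₀.le, hs₁⟩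
      exact this.ne' hz
  -- When the lower side is nonpositive, the upper branch exists over the whole interval and
  -- contains every zero with positive second coordinate.
  · have hV : Set.Icc (0 : ℝ) 1 ⊆ V := fun x hx => ⟨hx, 0, ⟨le_rfl, zero_le_one⟩, h0 x hx⟩
    have hs₀f : s₀ = f x₀ := by
      by_contra hne
      refine hbetween ((sInf_nonposSet_le ⟨⟨le_rfl, zero_le_one⟩, h0 x₀ hx₀⟩).trans_lt hs₀)
        (lt_of_le_of_ne (le_sSup_nonposSet hs₀A) hne)
    exact ⟨1, f 1, by simp, by rw [hs₀f]; exact joinf hV hx₀ ⟨zero_le_one, le_rfl⟩⟩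

end Roots

/-! ### Convexity and stationary points of the touching condition. -/

/-- The second derivative is twice the sum of the products of two slopes with the remaining factor,
and all factors are positive inside the interval. The condition `h₂₃` keeps these terms from
vanishing together. -/
theorem strictConvexOn_cubic {a₁ a₂ a₃ b₁ b₂ b₃ : ℝ} (c d : ℝ) (ha₁ : 0 < a₁) (ha₂ : 0 < a₂)
    (ha₃ : 0 < a₃) (hb₁ : 0 < b₁) (hb₂ : 0 ≤ b₂) (hb₃ : 0 ≤ b₃) (h₁ : b₁ ≤ a₁) (h₂ : b₂ ≤ a₂)
    (h₃ : b₃ ≤ a₃) (h₂₃ : 0 < b₂ + b₃) :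
    StrictConvexOn ℝ (Set.Icc (0 : ℝ) 1)
      fun s => (a₁ - s * b₁) * (a₂ - s * b₂) * (a₃ - s * b₃) - c * (d - s) := by
  set f : ℝ → ℝ := fun s => (a₁ - s * b₁) * (a₂ - s * b₂) * (a₃ - s * b₃) - c * (d - s) with hf
  have hlin : ∀ a b s : ℝ, HasDerivAt (fun s => a - s * b) (-b) s := fun a b s => by
    simpa using ((hasDerivAt_id s).mul_const b).const_sub a
  have hd1 : ∀ s, HasDerivAt f ((-b₁ * (a₂ - s * b₂) + (a₁ - s * b₁) * -b₂) * (a₃ - s * b₃) +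
      (a₁ - s * b₁) * (a₂ - s * b₂) * -b₃ - c * -1) s := fun s =>
    (((hlin _ _ s).mul (hlin _ _ s)).mul (hlin _ _ s)).sub
      (((hasDerivAt_id s).const_sub d).const_mul c)
  have hd1' : deriv f = fun s => (-b₁ * (a₂ - s * b₂) + (a₁ - s * b₁) * -b₂) * (a₃ - s * b₃) +
      (a₁ - s * b₁) * (a₂ - s * b₂) * -b₃ - c * -1 := funext fun s => (hd1 s).deriv
  have hd2 : ∀ s, deriv^[2] f s = 2 * (b₁ * b₂ * (a₃ - s * b₃) + b₁ * b₃ * (a₂ - s * b₂) +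
      b₂ * b₃ * (a₁ - s * b₁)) := by
    intro s
    rw [Function.iterate_succ, Function.iterate_one, Function.comp_apply, hd1']
    have := (((((hlin a₂ b₂ s).const_mul (-b₁)).add ((hlin a₁ b₁ s).mul_const (-b₂))).mul
      (hlin a₃ b₃ s)).add (((hlin a₁ b₁ s).mul (hlin a₂ b₂ s)).mul_const (-b₃))).sub_const (c * -1)
    refine Eq.trans this.deriv ?_
    simp only [Pi.add_apply]
    ring
  refine strictConvexOn_of_deriv2_pos (convex_Icc 0 1) (by fun_prop) fun s hs => ?_
  rw [interior_Icc] at hs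
  rw [hd2]
  have hp : ∀ {a b : ℝ}, 0 < a → 0 ≤ b → b ≤ a → 0 < a - s * b := by
    intro a b ha hb hba
    nlinarith [hs.1, hs.2]
  have p1 := hp ha₁ hb₁.le h₁
  have p2 := hp ha₂ hb₂ h₂
  have p3 := hp ha₃ hb₃ h₃
  rcases hb₂.eq_or_lt with h0 | h0
  · have : 0 < b₃ := by linarith
    have q1 := mul_pos (mul_pos hb₁ this) p2
    rw [← h0]
    rw [← h0] at q1
    linarith
  · have q1 := mul_pos (mul_pos hb₁ h0) p3
    have q2 := mul_nonneg (mul_nonneg hb₁.le hb₃) p2.le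
    have q3 := mul_nonneg (mul_nonneg hb₂ hb₃) p1.le
    linarith

/-- The system that expresses that the circumradius of the projection of a triangle is stationary
with respect to the direction has no solution when the heights of the vertices are distinct. -/
theorem no_stationary_direction {z₁ z₂ a b m c : ℝ} (hz₁ : 0 < z₁) (hz₂ : 0 < z₂) (hz : z₂ < z₁)
    (ha : 0 < a) (hb : 0 < b) (hd : 0 < a + b - 2 * m)
    (h0 : a * b * (a + b - 2 * m) = c * (a * b - m ^ 2))
    (h1 : z₁ * b * (a + b - 2 * m) + (z₁ - z₂) * a * b = c * (b * z₁ - m * z₂))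
    (h2 : z₂ * a * (a + b - 2 * m) - (z₁ - z₂) * a * b = c * (a * z₂ - m * z₁)) : False := by
  -- The combinations eliminate `c`. Here `a`, `b`, `m` are the Gram entries of the projected edges,
  -- so the resulting `m = a` or `m = b` is a right angle at the vertex of height `z₁` or `z₂`;
  -- either contradicts positivity.
  have e1 : (z₁ - z₂) * b * (a - m) + m * z₂ * (a + b - 2 * m) = 0 := by
    have : a * ((z₁ - z₂) * b * (a - m) + m * z₂ * (a + b - 2 * m)) = 0 := by
      linear_combination a * h1 + m * h2 - z₁ * h0
    exact (mul_eq_zero.1 this).resolve_left ha.ne'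
  have e2 : m * z₁ * (a + b - 2 * m) + (z₁ - z₂) * a * (m - b) = 0 := by
    have : b * (m * z₁ * (a + b - 2 * m) + (z₁ - z₂) * a * (m - b)) = 0 := by
      linear_combination m * h1 + b * h2 - z₂ * h0
    exact (mul_eq_zero.1 this).resolve_left hb.ne'
  have e3 : (m - a) * (m - b) = 0 := by
    have : (z₁ - z₂) * ((m - a) * (m - b)) = 0 := by linear_combination (1 / 2) * e1 - (1 / 2) * e2
    exact (mul_eq_zero.1 this).resolve_left (by linarith)
  rcases mul_eq_zero.1 e3 with h | h
  · have hm : m = a := by linarith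
    rw [hm] at e1 hd
    have := mul_pos (mul_pos ha hz₂) hd
    nlinarith
  · have hm : m = b := by linarith
    rw [hm] at e2 hd
    have := mul_pos (mul_pos hb hz₁) hd
    nlinarith

/-- At a local minimum with value zero both partial derivatives in the heights vanish. With the
value equation, they form the system of `no_stationary_direction`. -/
theorem not_isLocalMin_sideProd {α β γ c Δ z₁ z₂ : ℝ} (hz₁ : 0 < z₁) (hz₂ : 0 < z₂) (hz : z₂ < z₁)
    (h₁ : 0 < α - z₁ ^ 2) (h₂ : 0 < γ - z₂ ^ 2) (h₃ : 0 < α + γ - 2 * β - (z₁ - z₂) ^ 2)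
    (hΔ : Δ = α * γ - β ^ 2)
    (hval : (α - z₁ ^ 2) * (γ - z₂ ^ 2) * (α + γ - 2 * β - (z₁ - z₂) ^ 2) -
      c * (Δ - (γ * z₁ ^ 2 - 2 * β * z₁ * z₂ + α * z₂ ^ 2)) = 0)
    (hmin : ∀ᶠ z : ℝ × ℝ in nhds (z₁, z₂),
      0 ≤ (α - z.1 ^ 2) * (γ - z.2 ^ 2) * (α + γ - 2 * β - (z.1 - z.2) ^ 2) -
        c * (Δ - (γ * z.1 ^ 2 - 2 * β * z.1 * z.2 + α * z.2 ^ 2))) : False := by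
  have hsq : ∀ v : ℝ, HasDerivAt (fun v : ℝ => v ^ 2) (2 * v) v := fun v => by
    simpa using hasDerivAt_pow 2 v
  have hd1 : HasDerivAt (fun v => (α - v ^ 2) * (γ - z₂ ^ 2) * (α + γ - 2 * β - (v - z₂) ^ 2) -
      c * (Δ - (γ * v ^ 2 - 2 * β * v * z₂ + α * z₂ ^ 2)))
      ((-(2 * z₁) * (γ - z₂ ^ 2)) * (α + γ - 2 * β - (z₁ - z₂) ^ 2) +
        (α - z₁ ^ 2) * (γ - z₂ ^ 2) * -(2 * (z₁ - z₂)) -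
        c * -(γ * (2 * z₁) - 2 * β * 1 * z₂)) z₁ := by
    have k1 : HasDerivAt (fun v => (α - v ^ 2) * (γ - z₂ ^ 2)) (-(2 * z₁) * (γ - z₂ ^ 2)) z₁ :=
      ((hsq z₁).const_sub α).mul_const (γ - z₂ ^ 2)
    have k2 : HasDerivAt (fun v => α + γ - 2 * β - (v - z₂) ^ 2) (-(2 * (z₁ - z₂))) z₁ :=
      ((hsq (z₁ - z₂)).comp_sub_const z₁ z₂).const_sub (α + γ - 2 * β)
    have k3 : HasDerivAt (fun v => Δ - (γ * v ^ 2 - 2 * β * v * z₂ + α * z₂ ^ 2))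
        (-(γ * (2 * z₁) - 2 * β * 1 * z₂)) z₁ :=
      ((((hsq z₁).const_mul γ).sub (((hasDerivAt_id z₁).const_mul (2 * β)).mul_const
        z₂)).add_const (α * z₂ ^ 2)).const_sub Δ
    exact (k1.mul k2).sub (k3.const_mul c)
  have hd2 : HasDerivAt (fun w => (α - z₁ ^ 2) * (γ - w ^ 2) * (α + γ - 2 * β - (z₁ - w) ^ 2) -
      c * (Δ - (γ * z₁ ^ 2 - 2 * β * z₁ * w + α * w ^ 2)))
      (((α - z₁ ^ 2) * -(2 * z₂)) * (α + γ - 2 * β - (z₁ - z₂) ^ 2) +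
        (α - z₁ ^ 2) * (γ - z₂ ^ 2) * -(-(2 * (z₁ - z₂))) -
        c * -(-(2 * β * z₁ * 1) + α * (2 * z₂))) z₂ := by
    have k1 : HasDerivAt (fun w => (α - z₁ ^ 2) * (γ - w ^ 2)) ((α - z₁ ^ 2) * -(2 * z₂)) z₂ :=
      ((hsq z₂).const_sub γ).const_mul (α - z₁ ^ 2)
    have k2 : HasDerivAt (fun w => α + γ - 2 * β - (z₁ - w) ^ 2) (-(-(2 * (z₁ - z₂)))) z₂ :=
      ((hsq (z₁ - z₂)).comp_const_sub z₁ z₂).const_sub (α + γ - 2 * β)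
    have k3 : HasDerivAt (fun w => Δ - (γ * z₁ ^ 2 - 2 * β * z₁ * w + α * w ^ 2))
        (-(-(2 * β * z₁ * 1) + α * (2 * z₂))) z₂ :=
      ((((hasDerivAt_id z₂).const_mul (2 * β * z₁)).const_sub (γ * z₁ ^ 2)).add
        ((hsq z₂).const_mul α)).const_sub Δ
    exact (k1.mul k2).sub (k3.const_mul c)
  have hc1 : Continuous fun v : ℝ => (v, z₂) := by fun_prop
  have hc2 : Continuous fun w : ℝ => (z₁, w) := by fun_prop
  have hz1 := IsLocalMin.hasDerivAt_eq_zero (f := fun v => (α - v ^ 2) * (γ - z₂ ^ 2) *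
      (α + γ - 2 * β - (v - z₂) ^ 2) - c * (Δ - (γ * v ^ 2 - 2 * β * v * z₂ + α * z₂ ^ 2))) (by
    filter_upwards [(hc1.tendsto z₁).eventually hmin] with v hv
    rw [hval]
    exact hv) hd1
  have hz2 := IsLocalMin.hasDerivAt_eq_zero (f := fun w => (α - z₁ ^ 2) * (γ - w ^ 2) *
      (α + γ - 2 * β - (z₁ - w) ^ 2) - c * (Δ - (γ * z₁ ^ 2 - 2 * β * z₁ * w + α * w ^ 2))) (by
    filter_upwards [(hc2.tendsto z₂).eventually hmin] with w hw
    rw [hval]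
    exact hw) hd2
  refine no_stationary_direction (a := α - z₁ ^ 2) (b := γ - z₂ ^ 2) (m := β - z₁ * z₂) (c := c)
    hz₁ hz₂ hz h₁ h₂ (by linarith) ?_ ?_ ?_
  · have e : (α - z₁ ^ 2) * (γ - z₂ ^ 2) - (β - z₁ * z₂) ^ 2 =
        Δ - (γ * z₁ ^ 2 - 2 * β * z₁ * z₂ + α * z₂ ^ 2) := by
      rw [hΔ]; ring
    rw [e]
    linear_combination hval
  · linear_combination (-1 / 2) * hz1
  · linear_combination (-1 / 2) * hz2

/-! ### The touching condition in height ratio and squared planar length. -/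

section Touch

variable (α β γ : ℝ)

/-- The Gram determinant of two vectors. -/
def gramDet : ℝ := α * γ - β ^ 2

/-- The quadratic form adjoint to a Gram matrix, on the vector `(1, x)`. -/
def adjForm (x : ℝ) : ℝ := γ - 2 * β * x + α * x ^ 2

/-- The squared first height, at unit ratio, of the direction in the plane of the triangle. -/
noncomputable def heightSq (x : ℝ) : ℝ := gramDet α β γ / adjForm α β γ x

/-- The product of the squared lengths of the sides of the projection of a triangle. -/
noncomputable def sideProd (x s : ℝ) : ℝ :=
  (α - s * heightSq α β γ x) * (γ - s * (x ^ 2 * heightSq α β γ x)) *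
    (α + γ - 2 * β - s * ((1 - x) ^ 2 * heightSq α β γ x))

/-- The function whose zeros are the directions of the axes of the cylinders of squared radius `ρ`
through the vertices of a triangle. -/
noncomputable def touchFun (ρ x s : ℝ) : ℝ :=
  sideProd α β γ x s - 4 * ρ * gramDet α β γ * (1 - s)

variable {α β γ}

theorem gamma_pos (hα : 0 < α) (hΔ : 0 < gramDet α β γ) : 0 < γ := by
  unfold gramDet at hΔ
  by_contra hcon
  nlinarith [mul_nonneg hα.le (neg_nonneg.2 (not_lt.1 hcon)), sq_nonneg β]

theorem delta_pos (hα : 0 < α) (hΔ : 0 < gramDet α β γ) : 0 < α + γ - 2 * β := by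
  unfold gramDet at hΔ
  have : 0 < α * (α + γ - 2 * β) := by nlinarith [sq_nonneg (α - β)]
  exact pos_of_mul_pos_right this hα.le

theorem adjForm_pos (hα : 0 < α) (hΔ : 0 < gramDet α β γ) (x : ℝ) : 0 < adjForm α β γ x := by
  have : 0 < α * adjForm α β γ x := by
    unfold gramDet at hΔ
    unfold adjForm
    nlinarith [sq_nonneg (α * x - β)]
  exact pos_of_mul_pos_right this hα.le

theorem heightSq_pos (hα : 0 < α) (hΔ : 0 < gramDet α β γ) (x : ℝ) : 0 < heightSq α β γ x :=
  div_pos hΔ (adjForm_pos hα hΔ x)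

/-- A squared edge dominates its squared height; after clearing the denominator the difference is
the square `(α x - β)²`. The next two bounds are the same for the other edges. -/
theorem heightSq_le (hα : 0 < α) (hΔ : 0 < gramDet α β γ) (x : ℝ) : heightSq α β γ x ≤ α := by
  rw [heightSq, div_le_iff₀ (adjForm_pos hα hΔ x), gramDet, adjForm]
  nlinarith [sq_nonneg (α * x - β)]

theorem sq_mul_heightSq_le (hα : 0 < α) (hΔ : 0 < gramDet α β γ) (x : ℝ) :
    x ^ 2 * heightSq α β γ x ≤ γ := by
  rw [heightSq, ← mul_div_assoc, div_le_iff₀ (adjForm_pos hα hΔ x), gramDet, adjForm]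
  nlinarith [sq_nonneg (β * x - γ)]

theorem one_sub_sq_mul_heightSq_le (hα : 0 < α) (hΔ : 0 < gramDet α β γ) (x : ℝ) :
    (1 - x) ^ 2 * heightSq α β γ x ≤ α + γ - 2 * β := by
  rw [heightSq, ← mul_div_assoc, div_le_iff₀ (adjForm_pos hα hΔ x), gramDet, adjForm]
  nlinarith [sq_nonneg ((γ - β) + (α - β) * x)]

theorem continuous_touchFun (hα : 0 < α) (hΔ : 0 < gramDet α β γ) (ρ : ℝ) :
    Continuous (Function.uncurry (touchFun α β γ ρ)) := by
  have h : Continuous (heightSq α β γ) := by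
    unfold heightSq adjForm
    exact continuous_const.div (by fun_prop) fun x => (adjForm_pos hα hΔ x).ne'
  have : Continuous fun z : ℝ × ℝ => touchFun α β γ ρ z.1 z.2 := by
    unfold touchFun sideProd
    fun_prop
  exact this

theorem strictConvexOn_touchFun (hα : 0 < α) (hΔ : 0 < gramDet α β γ) (ρ x : ℝ) :
    StrictConvexOn ℝ (Set.Icc (0 : ℝ) 1) (touchFun α β γ ρ x) := by
  have hA := heightSq_pos hα hΔ x
  refine strictConvexOn_cubic (4 * ρ * gramDet α β γ) 1 hα (gamma_pos hα hΔ) (delta_pos hα hΔ) hA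
    (by positivity) (by positivity) (heightSq_le hα hΔ x) (sq_mul_heightSq_le hα hΔ x)
    (one_sub_sq_mul_heightSq_le hα hΔ x) ?_
  rw [← add_mul]
  refine mul_pos ?_ hA
  nlinarith [sq_nonneg (2 * x - 1)]

theorem touchFun_one_nonneg (hα : 0 < α) (hΔ : 0 < gramDet α β γ) (ρ x : ℝ) :
    0 ≤ touchFun α β γ ρ x 1 := by
  have h1 := heightSq_le hα hΔ x
  have h2 := sq_mul_heightSq_le hα hΔ x
  have h3 := one_sub_sq_mul_heightSq_le hα hΔ x
  unfold touchFun sideProd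
  rw [sub_self, mul_zero, sub_zero, one_mul, one_mul, one_mul]
  exact mul_nonneg (mul_nonneg (by linarith) (by linarith)) (by linarith)

/-- A nonpositive region enclosed by positive boundary values would contain an interior local
minimum of the projected circumradius, impossible for heights `0 < z₂ < z₁`. The bounds `0 < a` and
`b < 1` provide these inequalities. -/
theorem touchFun_pos_of_boundary (hα : 0 < α) (hΔ : 0 < gramDet α β γ) (ρ : ℝ) {a b : ℝ}
    (ha : 0 < a) (hb : b < 1) (hleft : ∀ s ∈ Set.Icc (0 : ℝ) 1, 0 < touchFun α β γ ρ a s)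
    (hright : ∀ s ∈ Set.Icc (0 : ℝ) 1, 0 < touchFun α β γ ρ b s)
    (hbot : ∀ x ∈ Set.Icc a b, 0 < touchFun α β γ ρ x 0)
    (htop : ∀ x ∈ Set.Icc a b, 0 < touchFun α β γ ρ x 1) :
    ∀ x ∈ Set.Icc a b, ∀ s ∈ Set.Icc (0 : ℝ) 1, 0 < touchFun α β γ ρ x s := by
  by_contra! hcon
  obtain ⟨x₁, hx₁, s₁, hs₁, hle₁⟩ := hcon
  set Δ := gramDet α β γ with hΔdef
  have hcont := continuous_touchFun hα hΔ ρ
  set Ω : Set (ℝ × ℝ) := (Set.Icc a b ×ˢ Set.Icc (0 : ℝ) 1) ∩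
    {z | Function.uncurry (touchFun α β γ ρ) z ≤ 0} with hΩ
  have hΩc : IsCompact Ω :=
    (isCompact_Icc.prod isCompact_Icc).inter_right (isClosed_le hcont continuous_const)
  have hΩ1 : ∀ z ∈ Ω, z.2 < 1 := by
    rintro ⟨x, s⟩ ⟨⟨hx, hs⟩, hle⟩
    refine lt_of_le_of_ne hs.2 fun h => ?_
    rw [Set.mem_ofPred_eq, Function.uncurry_apply_pair, show s = 1 from h] at hle
    exact absurd hle (not_le.2 (htop x hx))
  have hF : Continuous fun z : ℝ × ℝ => sideProd α β γ z.1 z.2 := by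
    have : Continuous fun z : ℝ × ℝ => Function.uncurry (touchFun α β γ ρ) z + 4 * ρ * Δ * (1 - z.2) := by
      fun_prop
    convert this using 2 with z
    simp [Function.uncurry, touchFun, hΔdef]
  -- The minimized quotient is `4 Δ` times the squared circumradius of the projection.
  obtain ⟨⟨x, s⟩, hxs, hmin⟩ := hΩc.exists_isMinOn ⟨(x₁, s₁), ⟨hx₁, hs₁⟩, hle₁⟩
    (f := fun z : ℝ × ℝ => sideProd α β γ z.1 z.2 / (1 - z.2))
    (hF.continuousOn.div (by fun_prop) fun z hz => by linarith [hΩ1 z hz])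
  have hs1 : s < 1 := hΩ1 _ hxs
  obtain ⟨⟨hx, hs⟩, hle⟩ := hxs
  simp only [Set.mem_ofPred_eq, Function.uncurry_apply_pair] at hx hs hle
  have hs0 : 0 < s := by
    refine lt_of_le_of_ne hs.1 fun h => ?_
    rw [← h] at hle
    exact absurd hle (not_le.2 (hbot x hx))
  have hax : a < x := by
    refine lt_of_le_of_ne hx.1 fun h => ?_
    rw [← h] at hle
    exact absurd hle (not_le.2 (hleft s hs))
  have hxb : x < b := by
    refine lt_of_le_of_ne hx.2 fun h => ?_
    rw [h] at hle
    exact absurd hle (not_le.2 (hright s hs))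
  set c := sideProd α β γ x s / (1 - s) with hc
  have hcs : sideProd α β γ x s = c * (1 - s) := by
    rw [hc, div_mul_cancel₀ _ (by linarith)]
  have hcρ : c ≤ 4 * ρ * Δ := by
    rw [hc, div_le_iff₀ (by linarith)]
    unfold touchFun at hle
    linarith
  -- near the minimum, the side product is at least `c (1 - s)`
  have hlocal : ∀ᶠ z : ℝ × ℝ in nhds (x, s), c * (1 - z.2) ≤ sideProd α β γ z.1 z.2 := by
    have hopen : Set.Ioo a b ×ˢ Set.Ioo (0 : ℝ) 1 ∈ nhds (x, s) :=
      prod_mem_nhds (Ioo_mem_nhds hax hxb) (Ioo_mem_nhds hs0 hs1)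
    filter_upwards [hopen] with z hz
    have hz2 : 0 < 1 - z.2 := by linarith [hz.2.2]
    by_cases hzΩ : z ∈ Ω
    · have := hmin hzΩ
      simp only [Set.mem_ofPred_eq] at this
      rwa [← hc, le_div_iff₀ hz2] at this
    · have : 0 < touchFun α β γ ρ z.1 z.2 := by
        by_contra hcon
        exact hzΩ ⟨⟨⟨hz.1.1.le, hz.1.2.le⟩, ⟨hz.2.1.le, hz.2.2.le⟩⟩, not_lt.1 hcon⟩
      unfold touchFun at this
      nlinarith [mul_le_mul_of_nonneg_right hcρ hz2.le]
  -- pass to the heights as coordinates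
  have hN := adjForm_pos hα hΔ x
  set z₁ := Real.sqrt (s * heightSq α β γ x) with hz₁
  have hz₁sq : z₁ ^ 2 = s * heightSq α β γ x :=
    Real.sq_sqrt (mul_nonneg hs.1 (heightSq_pos hα hΔ x).le)
  have hz₁pos : 0 < z₁ := Real.sqrt_pos.2 (mul_pos hs0 (heightSq_pos hα hΔ x))
  set z₂ := x * z₁ with hz₂
  have hxpos : 0 < x := ha.trans hax
  let K : ℝ → ℝ → ℝ := fun v w => Δ - (γ * v ^ 2 - 2 * β * v * w + α * w ^ 2)
  let F : ℝ → ℝ → ℝ := fun v w => (α - v ^ 2) * (γ - w ^ 2) * (α + γ - 2 * β - (v - w) ^ 2)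
  -- `T` turns the two heights into their ratio and the squared planar length. In heights, the side
  -- product and `Δ (1 - s)` are polynomials, so stationarity is easy to express.
  let T : ℝ × ℝ → ℝ × ℝ := fun z =>
    (z.2 / z.1, (γ * z.1 ^ 2 - 2 * β * z.1 * z.2 + α * z.2 ^ 2) / Δ)
  have hTF : ∀ z : ℝ × ℝ, z.1 ≠ 0 → sideProd α β γ (T z).1 (T z).2 = F z.1 z.2 := by
    rintro ⟨v, w⟩ hv
    simp only at hv
    have h1 : (T (v, w)).2 * heightSq α β γ (T (v, w)).1 = v ^ 2 := by
      have h2 : adjForm α β γ (w / v) * v ^ 2 = γ * v ^ 2 - 2 * β * v * w + α * w ^ 2 := by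
        unfold adjForm
        field_simp
      have h3 := (adjForm_pos hα hΔ (w / v)).ne'
      simp only [T, heightSq, ← hΔdef, ← h2]
      field_simp
    have e1 : (w / v) ^ 2 * v ^ 2 = w ^ 2 := by field_simp
    have e2 : (1 - w / v) ^ 2 * v ^ 2 = (v - w) ^ 2 := by field_simp
    rw [sideProd, mul_left_comm _ ((T (v, w)).1 ^ 2), mul_left_comm _ ((1 - (T (v, w)).1) ^ 2), h1]
    simp only [T, e1, e2, F]
  have hTK : ∀ z : ℝ × ℝ, Δ * (1 - (T z).2) = K z.1 z.2 := by
    intro z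
    simp only [T, K]
    field_simp
  have hTz : T (z₁, z₂) = (x, s) := by
    simp only [T, hz₂]
    ext
    · simp [hz₁pos.ne']
    · have : γ * z₁ ^ 2 - 2 * β * z₁ * (x * z₁) + α * (x * z₁) ^ 2 = z₁ ^ 2 * adjForm α β γ x := by
        unfold adjForm; ring
      change (γ * z₁ ^ 2 - 2 * β * z₁ * (x * z₁) + α * (x * z₁) ^ 2) / Δ = s
      rw [this, hz₁sq, heightSq, ← hΔdef]
      field_simp
  have hTc : ContinuousAt T (z₁, z₂) := by
    refine ContinuousAt.prodMk ?_ ?_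
    · exact ContinuousAt.div (by fun_prop) (by fun_prop) hz₁pos.ne'
    · fun_prop
  have hloc2 : ∀ᶠ z : ℝ × ℝ in nhds (z₁, z₂), 0 ≤ F z.1 z.2 - c / Δ * K z.1 z.2 := by
    have h1 : ∀ᶠ z in nhds (z₁, z₂), c * (1 - (T z).2) ≤ sideProd α β γ (T z).1 (T z).2 := by
      have := hTc.tendsto
      rw [hTz] at this
      exact this.eventually hlocal
    have h2 : ∀ᶠ z : ℝ × ℝ in nhds (z₁, z₂), z.1 ≠ 0 :=
      continuousAt_fst.eventually_ne hz₁pos.ne'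
    filter_upwards [h1, h2] with z hz1 hz2
    rw [hTF z hz2] at hz1
    rw [← hTK z]
    have : c / Δ * (Δ * (1 - (T z).2)) = c * (1 - (T z).2) := by field_simp
    linarith
  have hval : F z₁ z₂ - c / Δ * K z₁ z₂ = 0 := by
    rw [← hTF (z₁, z₂) hz₁pos.ne', ← hTK (z₁, z₂), hTz]
    have : c / Δ * (Δ * (1 - s)) = c * (1 - s) := by field_simp
    simp only
    rw [this, hcs, sub_self]
  have pos : ∀ {u v : ℝ}, 0 < u → v ≤ u → 0 ≤ v → 0 < u - s * v := by
    intro u v hu hvu hv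
    nlinarith
  have hA := heightSq_pos hα hΔ x
  have p1 := pos hα (heightSq_le hα hΔ x) hA.le
  have p2 := pos (gamma_pos hα hΔ) (sq_mul_heightSq_le hα hΔ x) (by positivity)
  have p3 := pos (delta_pos hα hΔ) (one_sub_sq_mul_heightSq_le hα hΔ x) (by positivity)
  rw [mul_left_comm, ← hz₁sq, ← mul_pow] at p2 p3
  rw [← hz₁sq] at p1
  rw [sub_mul, one_mul] at p3
  rw [← hz₂] at p2 p3
  have hz21 : z₂ < z₁ := by
    have : x < 1 := hxb.trans hb
    nlinarith
  refine not_isLocalMin_sideProd hz₁pos (mul_pos hxpos hz₁pos) hz21 p1 p2 (by linarith)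
    (c := c / Δ) (Δ := Δ) rfl hval hloc2

end Touch

/-! ### Continuous extension of quotients, and truncated paths. -/

theorem pos_on_Ico_of_ne_zero {f : ℝ → ℝ} {a b : ℝ} (hf : ContinuousOn f (Set.Ico a b))
    (h0 : ∀ t ∈ Set.Ico a b, f t ≠ 0) (ha : 0 < f a) {t : ℝ} (ht : t ∈ Set.Ico a b) : 0 < f t := by
  by_contra hcon
  obtain ⟨s, hs, hs0⟩ := intermediate_value_Icc' ht.1
    (hf.mono fun s hs => ⟨hs.1, hs.2.trans_lt ht.2⟩) ⟨not_lt.1 hcon, ha.le⟩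
  exact h0 s ⟨hs.1, hs.2.trans_lt ht.2⟩ hs0

/-- If the limit of `c` is zero, then `|f| = √c` tends to zero. Otherwise `f` has no zeros near `1`,
so its sign is constant there and `f` is `√c` or `-√c`. -/
theorem exists_tendsto_of_sq {f c : ℝ → ℝ} (hf : ContinuousOn f (Set.Ico 0 1)) (hc : Continuous c)
    (h : ∀ t ∈ Set.Ico (0 : ℝ) 1, f t ^ 2 = c t) :
    ∃ l, l ^ 2 = c 1 ∧ Filter.Tendsto f (nhdsWithin 1 (Set.Ico 0 1)) (nhds l) := by
  have hmem : ∀ᶠ t in nhdsWithin (1 : ℝ) (Set.Ico 0 1), t ∈ Set.Ico (0 : ℝ) 1 := self_mem_nhdsWithin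
  have hne : (nhdsWithin (1 : ℝ) (Set.Ico 0 1)).NeBot := by
    rw [← mem_closure_iff_nhdsWithin_neBot, closure_Ico zero_ne_one]
    exact ⟨zero_le_one, le_rfl⟩
  have hct : Filter.Tendsto c (nhdsWithin 1 (Set.Ico 0 1)) (nhds (c 1)) :=
    (hc.tendsto 1).mono_left nhdsWithin_le_nhds
  have hst : Filter.Tendsto (fun t => Real.sqrt (c t)) (nhdsWithin 1 (Set.Ico 0 1))
      (nhds (Real.sqrt (c 1))) := (Real.continuous_sqrt.tendsto _).comp hct
  have hc1 : 0 ≤ c 1 := by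
    refine ge_of_tendsto hct ?_
    filter_upwards [hmem] with t ht
    rw [← h t ht]
    exact sq_nonneg _
  rcases hc1.eq_or_lt with h1 | h1
  · refine ⟨0, by rw [← h1]; simp, ?_⟩
    rw [← h1, Real.sqrt_zero] at hst
    rw [tendsto_zero_iff_abs_tendsto_zero]
    refine hst.congr' ?_
    filter_upwards [hmem] with t ht
    rw [← h t ht, Real.sqrt_sq_eq_abs, Function.comp_apply]
  · obtain ⟨δ, hδ, hball⟩ := Metric.mem_nhds_iff.1 (hc.tendsto 1 |>.eventually_const_lt h1)
    set a := max 0 (1 - δ / 2) with ha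
    have ha1 : a < 1 := max_lt zero_lt_one (by linarith)
    have hsub : Set.Ico a 1 ⊆ Set.Ico 0 1 := Set.Ico_subset_Ico_left (le_max_left _ _)
    have hpos : ∀ t ∈ Set.Ico a 1, 0 < c t := by
      intro t ht
      refine hball ?_
      have : 1 - δ / 2 ≤ t := (le_max_right _ _).trans ht.1
      rw [Metric.mem_ball, Real.dist_eq, abs_sub_comm, abs_of_pos (by linarith [ht.2])]
      linarith
    have hf0 : ∀ t ∈ Set.Ico a 1, f t ≠ 0 := by
      intro t ht h0
      have := h t (hsub ht)
      rw [h0] at this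
      have := hpos t ht
      nlinarith
    have hev : ∀ᶠ t in nhdsWithin (1 : ℝ) (Set.Ico 0 1), t ∈ Set.Ico a 1 := by
      filter_upwards [hmem, nhdsWithin_le_nhds (Ioi_mem_nhds ha1)] with t ht hta
      exact ⟨le_of_lt hta, ht.2⟩
    rcases (hf0 a ⟨le_rfl, ha1⟩).lt_or_gt with hneg | hp
    · refine ⟨-Real.sqrt (c 1), by rw [neg_sq, Real.sq_sqrt hc1], hst.neg.congr' ?_⟩
      filter_upwards [hev] with t ht
      have := pos_on_Ico_of_ne_zero (f := fun t => -f t) (hf.mono hsub).neg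
        (fun t ht => neg_ne_zero.2 (hf0 t ht)) (by simpa using hneg) ht
      rw [← h t (hsub ht), Real.sqrt_sq_eq_abs, abs_of_neg (by linarith), neg_neg]
    · refine ⟨Real.sqrt (c 1), Real.sq_sqrt hc1, hst.congr' ?_⟩
      filter_upwards [hev] with t ht
      have := pos_on_Ico_of_ne_zero (hf.mono hsub) hf0 hp ht
      rw [← h t (hsub ht), Real.sqrt_sq_eq_abs, abs_of_pos this]

/-- This is for the normal component of the radial vector, a quotient whose denominator vanishes
when the axis becomes parallel to the plane of the triangle; its square stays continuous there. -/
theorem exists_continuous_quotient {a b c : ℝ → ℝ} (ha : Continuous a) (hb : Continuous b)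
    (hc : Continuous c) (hb0 : ∀ t ∈ Set.Ico (0 : ℝ) 1, 0 < b t)
    (h : ∀ t ∈ Set.Icc (0 : ℝ) 1, a t ^ 2 = c t * b t ^ 2) :
    ∃ m : ℝ → ℝ, ContinuousOn m (Set.Icc 0 1) ∧
      ∀ t ∈ Set.Icc (0 : ℝ) 1, m t * b t = a t ∧ m t ^ 2 = c t := by
  have hdiv : ∀ t, b t ≠ 0 → t ∈ Set.Icc (0 : ℝ) 1 →
      a t / b t * b t = a t ∧ (a t / b t) ^ 2 = c t := by
    intro t hbt ht
    refine ⟨div_mul_cancel₀ _ hbt, ?_⟩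
    rw [div_pow, h t ht, mul_div_cancel_right₀ _ (pow_ne_zero 2 hbt)]
  by_cases hb1 : b 1 = 0
  · have hcont : ContinuousOn (fun t => a t / b t) (Set.Ico 0 1) :=
      ha.continuousOn.div hb.continuousOn fun t ht => (hb0 t ht).ne'
    obtain ⟨l, hl, hlim⟩ := exists_tendsto_of_sq hcont hc
      fun t ht => (hdiv t (hb0 t ht).ne' ⟨ht.1, ht.2.le⟩).2
    refine ⟨Function.update (fun t => a t / b t) 1 l, ?_, fun t ht => ?_⟩
    · have hIco : Set.Icc (0 : ℝ) 1 \ {1} = Set.Ico 0 1 := by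
        ext t; simp [lt_iff_le_and_ne]
      rw [continuousOn_update_iff, hIco]
      exact ⟨hcont, fun _ => hlim⟩
    · rcases eq_or_ne t 1 with rfl | hne
      · have ha1 := h 1 ht
        rw [hb1] at ha1
        rw [Function.update_self, hb1, hl]
        exact ⟨by nlinarith, rfl⟩
      · rw [Function.update_of_ne hne]
        exact hdiv t (hb0 t ⟨ht.1, lt_of_le_of_ne ht.2 hne⟩).ne' ht
  · have hb' : ∀ t ∈ Set.Icc (0 : ℝ) 1, b t ≠ 0 := by
      intro t ht
      rcases eq_or_ne t 1 with rfl | hne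
      · exact hb1
      · exact (hb0 t ⟨ht.1, lt_of_le_of_ne ht.2 hne⟩).ne'
    exact ⟨fun t => a t / b t, ha.continuousOn.div hb.continuousOn hb',
      fun t ht => hdiv t (hb' t ht) ht⟩

/-- The part of a path before it first meets a closed set. -/
theorem exists_path_until_closed {X : Type*} [TopologicalSpace X] {Z E : Set X} {x y : X}
    (hxy : JoinedIn Z x y) (hE : IsClosed E) (hy : y ∈ E) (hx : x ∉ E) :
    ∃ f : ℝ → X, Continuous f ∧ f 0 = x ∧ (∀ t, f t ∈ Z) ∧ f 1 ∈ E ∧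
      ∀ t ∈ Set.Ico (0 : ℝ) 1, f t ∉ E := by
  obtain ⟨γ, hγ⟩ := hxy
  have hc : IsCompact (Set.Icc (0 : ℝ) 1 ∩ γ.extend ⁻¹' E) :=
    isCompact_Icc.inter_right (hE.preimage γ.continuous_extend)
  obtain ⟨t₀, ⟨ht₀, ht₀E⟩, hmin⟩ := hc.exists_isLeast ⟨1, ⟨zero_le_one, le_rfl⟩, by simpa using hy⟩
  have hpos : 0 < t₀ := by
    refine lt_of_le_of_ne ht₀.1 fun h => hx ?_
    rw [← h] at ht₀E
    simpa using ht₀E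
  refine ⟨fun t => γ.extend (t₀ * t), γ.continuous_extend.comp (by fun_prop), by simp,
    fun t => ?_, by simpa using ht₀E, fun t ht hcon => ?_⟩
  · have : γ.extend (t₀ * t) ∈ Set.range γ := by
      rw [← γ.extend_range]; exact ⟨_, rfl⟩
    obtain ⟨s, hs⟩ := this
    have h1 := hγ s
    rwa [hs] at h1
  · have h1 : t₀ * t < t₀ := by nlinarith [ht.2]
    exact absurd (hmin ⟨⟨mul_nonneg ht₀.1 ht.1, h1.le.trans ht₀.2⟩, hcon⟩) (not_le.2 h1)

/-! ### Coordinates with respect to two edges and the normal of their plane. -/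

section Decomposition

variable {f₁ f₂ n : E3}

/-- The vector in the plane of `f₁` and `f₂` with prescribed inner products with `f₁` and `f₂`. -/
noncomputable def dualVec (f₁ f₂ : E3) (y₁ y₂ : ℝ) : E3 :=
  (gramDet ⟪f₁, f₁⟫ ⟪f₁, f₂⟫ ⟪f₂, f₂⟫)⁻¹ •
    ((⟪f₂, f₂⟫ * y₁ - ⟪f₁, f₂⟫ * y₂) • f₁ + (⟪f₁, f₁⟫ * y₂ - ⟪f₁, f₂⟫ * y₁) • f₂)

theorem inner_dualVec_left (hΔ : gramDet ⟪f₁, f₁⟫ ⟪f₁, f₂⟫ ⟪f₂, f₂⟫ ≠ 0) (y₁ y₂ : ℝ) :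
    ⟪dualVec f₁ f₂ y₁ y₂, f₁⟫ = y₁ := by
  rw [dualVec, inner_smul_left, inner_add_left, inner_smul_left, inner_smul_left,
    real_inner_comm f₁ f₂]
  simp only [conj_trivial]
  rw [inv_mul_eq_iff_eq_mul₀ hΔ, gramDet]
  ring

theorem inner_dualVec_right (hΔ : gramDet ⟪f₁, f₁⟫ ⟪f₁, f₂⟫ ⟪f₂, f₂⟫ ≠ 0) (y₁ y₂ : ℝ) :
    ⟪dualVec f₁ f₂ y₁ y₂, f₂⟫ = y₂ := by
  rw [dualVec, inner_smul_left, inner_add_left, inner_smul_left, inner_smul_left]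
  simp only [conj_trivial]
  rw [inv_mul_eq_iff_eq_mul₀ hΔ, gramDet]
  ring

theorem inner_dualVec (hΔ : gramDet ⟪f₁, f₁⟫ ⟪f₁, f₂⟫ ⟪f₂, f₂⟫ ≠ 0) (y₁ y₂ z₁ z₂ : ℝ) :
    ⟪dualVec f₁ f₂ y₁ y₂, dualVec f₁ f₂ z₁ z₂⟫ =
      (⟪f₂, f₂⟫ * (y₁ * z₁) - ⟪f₁, f₂⟫ * (y₁ * z₂ + y₂ * z₁) + ⟪f₁, f₁⟫ * (y₂ * z₂)) /
        gramDet ⟪f₁, f₁⟫ ⟪f₁, f₂⟫ ⟪f₂, f₂⟫ := by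
  conv_lhs => rw [dualVec.eq_1 f₁ f₂ z₁ z₂, inner_smul_right, inner_add_right, inner_smul_right,
    inner_smul_right, inner_dualVec_left hΔ, inner_dualVec_right hΔ]
  field_simp
  ring

theorem inner_dualVec_normal (h₁ : ⟪n, f₁⟫ = 0) (h₂ : ⟪n, f₂⟫ = 0) (y₁ y₂ : ℝ) :
    ⟪dualVec f₁ f₂ y₁ y₂, n⟫ = 0 := by
  rw [real_inner_comm, dualVec, inner_smul_right, inner_add_right, inner_smul_right,
    inner_smul_right, h₁, h₂]
  simp

/-- A nonzero `d` would span the third direction of the frame of `f₁` and `n`. Then `f₂`, orthogonal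
to `d` and `n`, would be a multiple of `f₁`, and the Gram determinant would vanish. -/
theorem eq_zero_of_inner_eq_zero (hf₁ : 0 < ⟪f₁, f₁⟫)
    (hΔ : 0 < gramDet ⟪f₁, f₁⟫ ⟪f₁, f₂⟫ ⟪f₂, f₂⟫) (hn : ‖n‖ = 1) (h₁ : ⟪n, f₁⟫ = 0)
    (h₂ : ⟪n, f₂⟫ = 0) {d : E3} (d₁ : ⟪d, f₁⟫ = 0) (d₂ : ⟪d, f₂⟫ = 0) (d₃ : ⟪d, n⟫ = 0) : d = 0 := by
  have hf0 : f₁ ≠ 0 := by rintro rfl; simp at hf₁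
  have he : ‖‖f₁‖⁻¹ • f₁‖ = 1 := by simp [norm_smul, hf0]
  have hne : ⟪n, ‖f₁‖⁻¹ • f₁⟫ = 0 := by rw [inner_smul_right, h₁, mul_zero]
  set e := ‖f₁‖⁻¹ • f₁ with hedef
  have hde : ⟪d, e⟫ = 0 := by rw [hedef, inner_smul_right, d₁, mul_zero]
  set b := frame he hn hne
  have hexp : ∀ v : E3, v = ⟪e, v⟫ • e + ⟪n, v⟫ • n + ⟪cross e n, v⟫ • cross e n := by
    intro v
    have := b.sum_repr' v
    simpa [b, Fin.sum_univ_three, frame_apply] using this.symm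
  have hd : d = ⟪cross e n, d⟫ • cross e n := by
    conv_lhs => rw [hexp d]
    rw [real_inner_comm, hde, real_inner_comm, d₃]
    simp
  by_contra hd0
  have hc : ⟪cross e n, f₂⟫ = 0 := by
    rw [hd, inner_smul_left] at d₂
    refine (mul_eq_zero.1 d₂).resolve_left fun h => hd0 ?_
    rw [hd, show ⟪cross e n, d⟫ = 0 from h, zero_smul]
  have hf2 : f₂ = (⟪e, f₂⟫ * ‖f₁‖⁻¹) • f₁ := by
    conv_lhs => rw [hexp f₂, h₂, hc]
    rw [mul_smul, ← hedef]
    simp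
  have : gramDet ⟪f₁, f₁⟫ ⟪f₁, f₂⟫ ⟪f₂, f₂⟫ = 0 := by
    set c := ⟪e, f₂⟫ * ‖f₁‖⁻¹
    rw [gramDet, hf2, inner_smul_left, inner_smul_right]
    simp only [conj_trivial]
    ring
  exact hΔ.ne' this

theorem eq_dualVec_add (hf₁ : 0 < ⟪f₁, f₁⟫)
    (hΔ : 0 < gramDet ⟪f₁, f₁⟫ ⟪f₁, f₂⟫ ⟪f₂, f₂⟫) (hn : ‖n‖ = 1) (h₁ : ⟪n, f₁⟫ = 0)
    (h₂ : ⟪n, f₂⟫ = 0) (v : E3) :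
    v = dualVec f₁ f₂ ⟪v, f₁⟫ ⟪v, f₂⟫ + ⟪v, n⟫ • n := by
  rw [← sub_eq_zero]
  refine eq_zero_of_inner_eq_zero hf₁ hΔ hn h₁ h₂ ?_ ?_ ?_
  · rw [inner_sub_left, inner_add_left, inner_dualVec_left hΔ.ne', inner_smul_left, h₁]
    simp
  · rw [inner_sub_left, inner_add_left, inner_dualVec_right hΔ.ne', inner_smul_left, h₂]
    simp
  · rw [inner_sub_left, inner_add_left, inner_dualVec_normal h₁ h₂, inner_smul_left,
      real_inner_self_eq_norm_sq, hn]
    simp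

theorem inner_dualVec_add (hn : ‖n‖ = 1) (h₁ : ⟪n, f₁⟫ = 0) (h₂ : ⟪n, f₂⟫ = 0)
    (y₁ y₂ z₁ z₂ a b : ℝ) :
    ⟪dualVec f₁ f₂ y₁ y₂ + a • n, dualVec f₁ f₂ z₁ z₂ + b • n⟫ =
      ⟪dualVec f₁ f₂ y₁ y₂, dualVec f₁ f₂ z₁ z₂⟫ + a * b := by
  have h : ⟪n, dualVec f₁ f₂ z₁ z₂⟫ = 0 := by
    rw [real_inner_comm]
    exact inner_dualVec_normal h₁ h₂ z₁ z₂
  rw [inner_add_left, inner_add_right, inner_add_right, inner_smul_left, inner_smul_left,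
    inner_smul_right, inner_smul_right, inner_dualVec_normal h₁ h₂, h, real_inner_self_eq_norm_sq, hn]
  simp

end Decomposition

/-! ### Motions that keep three points on the surface. -/

theorem axisDistSq_sub_smul {u k x p : E3} {r : ℝ} (hk : ‖k‖ = 1) (hku : ⟪k, u⟫ = 0) :
    axisDistSq (p - r • k) u x =
      ⟪x - p, x - p⟫ + 2 * r * ⟪k, x - p⟫ + r ^ 2 - ⟪x - p, u⟫ ^ 2 := by
  have : x - (p - r • k) = (x - p) + r • k := by abel
  rw [axisDistSq, this, norm_add_sq_real, inner_add_left, inner_smul_left, inner_smul_right, hku,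
    norm_smul, hk, real_inner_self_eq_norm_sq, real_inner_comm]
  simp
  ring

/-- The relation between the heights of a triangle and the radius of the cylinder through its
vertices. -/
theorem touch_identity {α β γ Δ r z₁ z₂ : ℝ} (hΔ : Δ = α * γ - β ^ 2) (hΔ0 : Δ ≠ 0) (hr : r ≠ 0) :
    4 * r ^ 2 * Δ * ((1 - (γ * (z₁ * z₁) - β * (z₁ * z₂ + z₂ * z₁) + α * (z₂ * z₂)) / Δ) *
        (1 - (γ * (-(α - z₁ ^ 2) / (2 * r) * (-(α - z₁ ^ 2) / (2 * r))) -
          β * (-(α - z₁ ^ 2) / (2 * r) * (-(γ - z₂ ^ 2) / (2 * r)) +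
            -(γ - z₂ ^ 2) / (2 * r) * (-(α - z₁ ^ 2) / (2 * r))) +
          α * (-(γ - z₂ ^ 2) / (2 * r) * (-(γ - z₂ ^ 2) / (2 * r)))) / Δ) -
      ((γ * (-(α - z₁ ^ 2) / (2 * r) * z₁) -
          β * (-(α - z₁ ^ 2) / (2 * r) * z₂ + -(γ - z₂ ^ 2) / (2 * r) * z₁) +
          α * (-(γ - z₂ ^ 2) / (2 * r) * z₂)) / Δ) ^ 2) =
    4 * r ^ 2 * Δ * (1 - (γ * (z₁ * z₁) - β * (z₁ * z₂ + z₂ * z₁) + α * (z₂ * z₂)) / Δ) -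
      (α - z₁ ^ 2) * (γ - z₂ ^ 2) * (α + γ - 2 * β - (z₁ - z₂) ^ 2) := by
  field_simp
  rw [hΔ]
  ring

theorem sideProd_eq {α β γ x s z₁ z₂ : ℝ} (hz₁ : s * heightSq α β γ x = z₁ ^ 2)
    (hz₂ : z₂ = x * z₁) : sideProd α β γ x s =
      (α - z₁ ^ 2) * (γ - z₂ ^ 2) * (α + γ - 2 * β - (z₁ - z₂) ^ 2) := by
  rw [sideProd, mul_left_comm s, mul_left_comm s, hz₁, hz₂]
  ring

theorem planar_norm_eq {α β γ x s z₁ z₂ : ℝ} (hα : 0 < α) (hΔ : 0 < gramDet α β γ)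
    (hz₁ : s * heightSq α β γ x = z₁ ^ 2) (hz₂ : z₂ = x * z₁) :
    (γ * (z₁ * z₁) - β * (z₁ * z₂ + z₂ * z₁) + α * (z₂ * z₂)) / gramDet α β γ = s := by
  have h1 : γ * (z₁ * z₁) - β * (z₁ * z₂ + z₂ * z₁) + α * (z₂ * z₂) = z₁ ^ 2 * adjForm α β γ x := by
    rw [adjForm, hz₂]; ring
  have := (adjForm_pos hα hΔ x).ne'
  rw [h1, ← hz₁, heightSq]
  field_simp

/-- A curve of zeros of `touchFun` that ends at a side of the unit square. -/
theorem exists_touchFun_curve {α β γ ρ x₀ s₀ : ℝ} (hα : 0 < α) (hΔ : 0 < gramDet α β γ)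
    (hx₀ : 0 < x₀) (hx₁ : x₀ < 1) (hs₀ : 0 < s₀) (hs₁ : s₀ < 1)
    (hz : touchFun α β γ ρ x₀ s₀ = 0) :
    ∃ x s : ℝ → ℝ, Continuous x ∧ Continuous s ∧ x 0 = x₀ ∧ s 0 = s₀ ∧
      (∀ t, 0 ≤ s t ∧ s t ≤ 1 ∧ touchFun α β γ ρ (x t) (s t) = 0) ∧
      (∀ t ∈ Set.Ico (0 : ℝ) 1, s t < 1) ∧ (x 1 = 0 ∨ x 1 = 1 ∨ s 1 = 1) := by
  obtain ⟨x₁, s₁, hend, hjoin⟩ := exists_joinedIn_zeros (continuous_touchFun hα hΔ ρ)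
    (fun x _ => strictConvexOn_touchFun hα hΔ ρ x) (fun x _ => touchFun_one_nonneg hα hΔ ρ x)
    (by
      -- At `s = 0` the direction is normal to the plane and the ratio `x` is immaterial, so the
      -- sign is constant along the lower side.
      have h0 : ∀ x, touchFun α β γ ρ x 0 = α * γ * (α + γ - 2 * β) - 4 * ρ * gramDet α β γ := by
        intro x
        rw [touchFun, sideProd]
        ring
      simp only [h0]
      rcases lt_or_ge 0 (α * γ * (α + γ - 2 * β) - 4 * ρ * gramDet α β γ) with h | h
      · exact Or.inl fun _ _ => h
      · exact Or.inr fun _ _ => h)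
    (fun a b ha hb => touchFun_pos_of_boundary hα hΔ ρ ha hb) ⟨hx₀.le, hx₁.le⟩ hs₀ hs₁.le hz
  have hE : IsClosed {z : ℝ × ℝ | z.1 = 0 ∨ z.1 = 1 ∨ z.2 = 1} :=
    (isClosed_eq continuous_fst continuous_const).union
      ((isClosed_eq continuous_fst continuous_const).union
        (isClosed_eq continuous_snd continuous_const))
  obtain ⟨f, hf, hf0, hfZ, hf1, hfE⟩ := exists_path_until_closed hjoin hE hend (by
    rintro (h | h | h)
    · exact hx₀.ne' h
    · exact hx₁.ne h
    · exact hs₁.ne h)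
  refine ⟨fun t => (f t).1, fun t => (f t).2, continuous_fst.comp hf, continuous_snd.comp hf,
    by simp [hf0], by simp [hf0], fun t => ⟨(hfZ t).2.1.1, (hfZ t).2.1.2, (hfZ t).2.2⟩,
    fun t ht => ?_, hf1⟩
  exact lt_of_le_of_ne (hfZ t).2.1.2 fun h => hfE t ht (Or.inr (Or.inr h))

set_option maxHeartbeats 1600000 in
/-- A motion of a cylinder that keeps passing through three points and that ends at a direction
orthogonal to or parallel to a side of their triangle. -/
theorem exists_touching_motion {r : ℝ} (hr : 0 < r) {o u p q s n : E3} (hu : ‖u‖ = 1)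
    (hp : axisDistSq o u p = r ^ 2) (hq : axisDistSq o u q = r ^ 2)
    (hs : axisDistSq o u s = r ^ 2) (hα : 0 < ⟪q - p, q - p⟫)
    (hΔ : 0 < gramDet ⟪q - p, q - p⟫ ⟪q - p, s - p⟫ ⟪s - p, s - p⟫) (hn : ‖n‖ = 1)
    (hn₁ : ⟪n, q - p⟫ = 0) (hn₂ : ⟪n, s - p⟫ = 0) (hun : 0 < ⟪u, n⟫)
    (hz₂ : 0 < ⟪u, s - p⟫) (hz₁₂ : ⟪u, s - p⟫ < ⟪u, q - p⟫) :
    ∃ w v k : unitInterval → E3, Continuous w ∧ Continuous v ∧ Continuous k ∧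
      (∀ t, ‖v t‖ = 1) ∧ (∀ t, ‖k t‖ = 1) ∧ (∀ t, ⟪k t, v t⟫ = 0) ∧
      (∀ t, axisDistSq (w t) (v t) p = r ^ 2 ∧ axisDistSq (w t) (v t) q = r ^ 2 ∧
        axisDistSq (w t) (v t) s = r ^ 2) ∧ v 0 = u ∧ (∃ c : ℝ, w 0 = o + c • u) ∧
      (⟪s - p, v 1⟫ = 0 ∨ ⟪q - s, v 1⟫ = 0 ∨ ‖q - p‖ ^ 2 = ⟪q - p, v 1⟫ ^ 2 ∨
        ‖s - p‖ ^ 2 = ⟪s - p, v 1⟫ ^ 2 ∨ ‖q - s‖ ^ 2 = ⟪q - s, v 1⟫ ^ 2) := by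
  obtain ⟨k₀, b, c₀, hk₀, hk₀u, hb, hpe, hpb⟩ := exists_radial (o := o) hu p
  have hbr : b = r := by
    rw [hp] at hpb
    exact ((sq_eq_sq₀ hr.le hb).1 hpb).symm
  subst hbr
  have hpo : p - b • k₀ = o + c₀ • u := by rw [hpe]; abel
  have hqs : q - s = (q - p) - (s - p) := by abel
  have hk : ∀ x, axisDistSq o u x = b ^ 2 →
      ⟪k₀, x - p⟫ = -(⟪x - p, x - p⟫ - ⟪u, x - p⟫ ^ 2) / (2 * b) := by
    intro x hx
    rw [← axisDistSq_origin_add_smul hu o x c₀, ← hpo, axisDistSq_sub_smul hk₀ hk₀u,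
      real_inner_comm u (x - p)] at hx
    rw [eq_div_iff (by positivity)]
    linarith
  have hkq := hk q hq
  have hks := hk s hs
  set f₁ := q - p with hf₁
  set f₂ := s - p with hf₂
  set α := ⟪f₁, f₁⟫ with hαd
  set β := ⟪f₁, f₂⟫ with hβd
  set γ := ⟪f₂, f₂⟫ with hγd
  set Δ := gramDet α β γ with hΔd
  set ζ₁ := ⟪u, f₁⟫ with hζ₁
  set ζ₂ := ⟪u, f₂⟫ with hζ₂
  have hζ₁pos : 0 < ζ₁ := hz₂.trans hz₁₂
  have hdec := eq_dualVec_add hα hΔ hn hn₁ hn₂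
  -- the norm of a vector in terms of its heights
  have huu : ⟪dualVec f₁ f₂ ζ₁ ζ₂, dualVec f₁ f₂ ζ₁ ζ₂⟫ + ⟪u, n⟫ * ⟪u, n⟫ = 1 := by
    rw [← inner_dualVec_add hn hn₁ hn₂, ← hdec u, real_inner_self_eq_norm_sq, hu]
    simp
  have hku : ⟪dualVec f₁ f₂ ⟪k₀, f₁⟫ ⟪k₀, f₂⟫, dualVec f₁ f₂ ζ₁ ζ₂⟫ + ⟪k₀, n⟫ * ⟪u, n⟫ = 0 := by
    rw [← inner_dualVec_add hn hn₁ hn₂, ← hdec u, ← hdec k₀, hk₀u]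
  have hkk : ⟪dualVec f₁ f₂ ⟪k₀, f₁⟫ ⟪k₀, f₂⟫, dualVec f₁ f₂ ⟪k₀, f₁⟫ ⟪k₀, f₂⟫⟫ +
      ⟪k₀, n⟫ * ⟪k₀, n⟫ = 1 := by
    rw [← inner_dualVec_add hn hn₁ hn₂, ← hdec k₀, real_inner_self_eq_norm_sq, hk₀]
    simp
  -- With the axis through `p - b • k`, touching at `q` and `s` forces these inner products of the
  -- radial vector `k` with the two edges.
  let y₁ : ℝ → ℝ := fun z => -(α - z ^ 2) / (2 * b)
  let y₂ : ℝ → ℝ := fun z => -(γ - z ^ 2) / (2 * b)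
  let A : ℝ → ℝ → ℝ := fun z₁ z₂ => ⟪dualVec f₁ f₂ z₁ z₂, dualVec f₁ f₂ z₁ z₂⟫
  let B : ℝ → ℝ → ℝ := fun z₁ z₂ =>
    ⟪dualVec f₁ f₂ (y₁ z₁) (y₂ z₂), dualVec f₁ f₂ (y₁ z₁) (y₂ z₂)⟫
  let C : ℝ → ℝ → ℝ := fun z₁ z₂ => ⟪dualVec f₁ f₂ (y₁ z₁) (y₂ z₂), dualVec f₁ f₂ z₁ z₂⟫
  -- The normal components of a unit direction and of a unit radial vector have squares `1 - A` and
  -- `1 - B`, and orthogonality makes their product `-C`. The identity shows that these requirements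
  -- are compatible exactly on the zeros of `touchFun`.
  have hident : ∀ z₁ z₂, 4 * b ^ 2 * Δ * ((1 - A z₁ z₂) * (1 - B z₁ z₂) - C z₁ z₂ ^ 2) =
      4 * b ^ 2 * Δ * (1 - A z₁ z₂) -
        (α - z₁ ^ 2) * (γ - z₂ ^ 2) * (α + γ - 2 * β - (z₁ - z₂) ^ 2) := by
    intro z₁ z₂
    simp only [A, B, C, inner_dualVec hΔ.ne']
    exact touch_identity rfl hΔ.ne' hr.ne'
  have hkq' : ⟪k₀, f₁⟫ = y₁ ζ₁ := hkq
  have hks' : ⟪k₀, f₂⟫ = y₂ ζ₂ := hks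
  rw [hkq', hks'] at hku hkk
  -- the starting point on the curve
  set x₀ := ζ₂ / ζ₁ with hx₀
  set s₀ := A ζ₁ ζ₂ with hs₀
  have hx₀z : ζ₂ = x₀ * ζ₁ := by rw [hx₀, div_mul_cancel₀ _ hζ₁pos.ne']
  have hs₀h : s₀ * heightSq α β γ x₀ = ζ₁ ^ 2 := by
    have h1 : A ζ₁ ζ₂ = ζ₁ ^ 2 * adjForm α β γ x₀ / Δ := by
      simp only [A, inner_dualVec hΔ.ne']
      rw [adjForm, hx₀z]
      ring
    have := (adjForm_pos hα hΔ x₀).ne'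
    rw [hs₀, h1, heightSq, ← hΔd]
    field_simp
  have hz₀ : touchFun α β γ (b ^ 2) x₀ s₀ = 0 := by
    rw [touchFun, sideProd_eq hs₀h hx₀z]
    have h1 := hident ζ₁ ζ₂
    have h2 : (1 - A ζ₁ ζ₂) * (1 - B ζ₁ ζ₂) - C ζ₁ ζ₂ ^ 2 = 0 := by
      have e1 : 1 - A ζ₁ ζ₂ = ⟪u, n⟫ * ⟪u, n⟫ := by linarith
      have e2 : 1 - B ζ₁ ζ₂ = ⟪k₀, n⟫ * ⟪k₀, n⟫ := by linarith
      have e3 : C ζ₁ ζ₂ = -(⟪k₀, n⟫ * ⟪u, n⟫) := by linarith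
      rw [e1, e2, e3]
      ring
    rw [h2, mul_zero] at h1
    linarith
  have hs₀pos : 0 < s₀ := by
    have h1 := heightSq_pos hα hΔ x₀
    have h2 : 0 < s₀ * heightSq α β γ x₀ := by rw [hs₀h]; positivity
    exact pos_of_mul_pos_left h2 h1.le
  have hs₀1 : s₀ < 1 := by nlinarith
  obtain ⟨x, σ, hxc, hσc, hx0, hσ0, hZ, hσ1, hend⟩ := exists_touchFun_curve hα hΔ
    (div_pos hz₂ hζ₁pos) ((div_lt_one hζ₁pos).2 hz₁₂) hs₀pos hs₀1 hz₀
  have hHc : Continuous (heightSq α β γ) := by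
    unfold heightSq adjForm
    exact continuous_const.div (by fun_prop) fun x => (adjForm_pos hα hΔ x).ne'
  let z₁ : ℝ → ℝ := fun t => Real.sqrt (σ t * heightSq α β γ (x t))
  let z₂ : ℝ → ℝ := fun t => x t * z₁ t
  have hz₁c : Continuous z₁ := by fun_prop
  have hz₂c : Continuous z₂ := by fun_prop
  have hz₁sq : ∀ t, σ t * heightSq α β γ (x t) = z₁ t ^ 2 := fun t =>
    (Real.sq_sqrt (mul_nonneg (hZ t).1 (heightSq_pos hα hΔ _).le)).symm
  have hA : ∀ t, A (z₁ t) (z₂ t) = σ t := by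
    intro t
    simp only [A, inner_dualVec hΔ.ne']
    exact planar_norm_eq hα hΔ (hz₁sq t) rfl
  have hside : ∀ t, (α - z₁ t ^ 2) * (γ - z₂ t ^ 2) * (α + γ - 2 * β - (z₁ t - z₂ t) ^ 2) =
      4 * b ^ 2 * Δ * (1 - σ t) := by
    intro t
    have := (hZ t).2.2
    rw [touchFun, sideProd_eq (hz₁sq t) (z₂ := z₂ t) rfl] at this
    linarith
  have hCBA : ∀ t, C (z₁ t) (z₂ t) ^ 2 = (1 - B (z₁ t) (z₂ t)) * (1 - σ t) := by
    intro t
    have h1 := hident (z₁ t) (z₂ t)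
    rw [hside t, hA t, sub_self] at h1
    have h2 := (mul_eq_zero.1 h1).resolve_left (by positivity)
    linarith
  have hdualc : ∀ {g h : ℝ → ℝ}, Continuous g → Continuous h →
      Continuous fun t => dualVec f₁ f₂ (g t) (h t) := by
    intro g h hg hh
    unfold dualVec
    fun_prop
  have hy₁c : Continuous fun t => y₁ (z₁ t) := by fun_prop
  have hy₂c : Continuous fun t => y₂ (z₂ t) := by fun_prop
  have hbc : Continuous fun t => Real.sqrt (1 - σ t) := by fun_prop
  -- Orthogonality determines the normal component `m` of `k` as `-C / √(1 - σ)`; it must be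
  -- extended continuously to time `1`, where `σ` may equal `1`.
  obtain ⟨m, hmc, hm⟩ := exists_continuous_quotient
    (a := fun t => -C (z₁ t) (z₂ t)) (b := fun t => Real.sqrt (1 - σ t))
    (c := fun t => 1 - B (z₁ t) (z₂ t))
    ((hdualc hy₁c hy₂c).inner (hdualc hz₁c hz₂c)).neg hbc
    (continuous_const.sub ((hdualc hy₁c hy₂c).inner (hdualc hy₁c hy₂c)))
    (fun t ht => Real.sqrt_pos.2 (by linarith [hσ1 t ht]))
    (fun t _ => by
      rw [neg_sq, hCBA, Real.sq_sqrt (by linarith [(hZ t).2.1])])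
  let v : unitInterval → E3 := fun t =>
    dualVec f₁ f₂ (z₁ t) (z₂ t) + Real.sqrt (1 - σ t) • n
  let k : unitInterval → E3 := fun t =>
    dualVec f₁ f₂ (y₁ (z₁ t)) (y₂ (z₂ t)) + m t • n
  have hvc : Continuous v :=
    ((hdualc hz₁c hz₂c).comp continuous_subtype_val).add
      ((hbc.comp continuous_subtype_val).smul continuous_const)
  have hkc : Continuous k :=
    ((hdualc hy₁c hy₂c).comp continuous_subtype_val).add
      ((continuousOn_iff_continuous_domRestrict.1 hmc).smul continuous_const)
  have norm_one : ∀ w : E3, ⟪w, w⟫ = 1 → ‖w‖ = 1 := by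
    intro w hw
    rw [norm_eq_sqrt_real_inner, hw, Real.sqrt_one]
  have hv1 : ∀ t, ‖v t‖ = 1 := by
    intro t
    refine norm_one _ ?_
    simp only [v]
    rw [inner_dualVec_add hn hn₁ hn₂, Real.mul_self_sqrt (by linarith [(hZ t).2.1])]
    have : ⟪dualVec f₁ f₂ (z₁ t) (z₂ t), dualVec f₁ f₂ (z₁ t) (z₂ t)⟫ = σ t := hA t
    rw [this]
    ring
  have hk1 : ∀ t, ‖k t‖ = 1 := by
    intro t
    refine norm_one _ ?_
    simp only [k]
    rw [inner_dualVec_add hn hn₁ hn₂, ← sq, (hm t t.2).2]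
    simp only [B]
    ring
  have hkv : ∀ t, ⟪k t, v t⟫ = 0 := by
    intro t
    simp only [k, v]
    rw [inner_dualVec_add hn hn₁ hn₂, (hm t t.2).1]
    simp only [C]
    ring
  have hv₁ : ∀ t, ⟪f₁, v t⟫ = z₁ t := by
    intro t
    rw [real_inner_comm]
    simp only [v]
    rw [inner_add_left, inner_smul_left, inner_dualVec_left hΔ.ne', hn₁, mul_zero, add_zero]
  have hv₂ : ∀ t, ⟪f₂, v t⟫ = z₂ t := by
    intro t
    rw [real_inner_comm]
    simp only [v]
    rw [inner_add_left, inner_smul_left, inner_dualVec_right hΔ.ne', hn₂, mul_zero, add_zero]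
  have hk₁ : ∀ t, ⟪k t, f₁⟫ = y₁ (z₁ t) := by
    intro t
    simp only [k]
    rw [inner_add_left, inner_smul_left, inner_dualVec_left hΔ.ne', hn₁, mul_zero, add_zero]
  have hk₂ : ∀ t, ⟪k t, f₂⟫ = y₂ (z₂ t) := by
    intro t
    simp only [k]
    rw [inner_add_left, inner_smul_left, inner_dualVec_right hΔ.ne', hn₂, mul_zero, add_zero]
  have hz₁0 : z₁ 0 = ζ₁ := by
    simp only [z₁, hx0, hσ0]
    rw [← hx₀, hs₀h]
    exact Real.sqrt_sq hζ₁pos.le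
  have hz₂0 : z₂ 0 = ζ₂ := by
    simp only [z₂]
    rw [hz₁0, hx0, ← hx₀z]
  have hσ0' : Real.sqrt (1 - σ 0) = ⟪u, n⟫ := by
    rw [hσ0, show 1 - s₀ = ⟪u, n⟫ * ⟪u, n⟫ by linarith, Real.sqrt_mul_self hun.le]
  have hv0 : v 0 = u := by
    simp only [v, Set.Icc.coe_zero]
    rw [hσ0', hz₁0, hz₂0, ← hdec u]
  have hk0 : k 0 = k₀ := by
    have h1 := (hm 0 ⟨le_rfl, zero_le_one⟩).1
    rw [hσ0', hz₁0, hz₂0] at h1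
    have h2 : m 0 = ⟪k₀, n⟫ := by
      have : m 0 * ⟪u, n⟫ = ⟪k₀, n⟫ * ⟪u, n⟫ := by linarith
      exact mul_right_cancel₀ hun.ne' this
    simp only [k, Set.Icc.coe_zero]
    rw [hz₁0, hz₂0, h2, ← hkq', ← hks', ← hdec k₀]
  refine ⟨fun t => p - b • k t, v, k, by fun_prop, hvc, hkc, hv1, hk1, hkv, fun t => ⟨?_, ?_, ?_⟩,
    hv0, ⟨c₀, by change p - b • k 0 = _; rw [hk0, hpo]⟩, ?_⟩
  · rw [axisDistSq_sub_smul (hk1 t) (hkv t), sub_self]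
    simp
  · rw [axisDistSq_sub_smul (hk1 t) (hkv t), ← hf₁, hk₁, hv₁, ← hαd]
    simp only [y₁]
    field_simp
    ring
  · rw [axisDistSq_sub_smul (hk1 t) (hkv t), ← hf₂, hk₂, hv₂, ← hγd]
    simp only [y₂]
    field_simp
    ring
  · have hv₁₂ : ⟪f₁ - f₂, v 1⟫ = z₁ 1 - z₂ 1 := by
      rw [inner_sub_left, hv₁, hv₂, Set.Icc.coe_one]
    rw [hqs, hv₁₂, hv₁, hv₂, ← real_inner_self_eq_norm_sq f₁, ← real_inner_self_eq_norm_sq f₂,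
      ← real_inner_self_eq_norm_sq (f₁ - f₂), real_inner_sub_sub_self f₁ f₂, ← hαd, ← hβd, ← hγd]
    simp only [Set.Icc.coe_one]
    rcases hend with h | h | h
    · left
      simp [z₂, h]
    · right; left
      simp [z₂, h]
    · have := hside 1
      rw [h, sub_self, mul_zero] at this
      rcases mul_eq_zero.1 this with h | h
      · rcases mul_eq_zero.1 h with h | h
        · right; right; left; linarith
        · right; right; right; left; linarith
      · right; right; right; right; linarith

/-! ### Special positions of the axis relative to a side of the triangle. -/

theorem specialPosition_of_parallel {o u p q : E3} {r : ℝ} (hr : 0 < r) (hu : ‖u‖ = 1)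
    (hp : axisDistSq o u p = r ^ 2) (hpq : p ≠ q) (h : ‖q - p‖ ^ 2 = ⟪q - p, u⟫ ^ 2) :
    SpecialPosition (axisLine o u) p q r := by
  left
  have h1 : q - p - ⟪q - p, u⟫ • u = 0 := by
    have := axisDistSq_eq_norm_sq (o := p) hu q
    rw [axisDistSq, h, sub_self] at this
    exact norm_eq_zero.1 (pow_eq_zero_iff two_ne_zero |>.1 this.symm)
  set c := ⟪q - p, u⟫
  have hc : c ≠ 0 := by
    intro h0
    rw [h0, zero_smul, sub_zero, sub_eq_zero] at h1
    exact hpq h1.symm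
  have hq : q = p + c • u := by
    rw [sub_eq_zero] at h1
    rw [← h1]; abel
  have hspan : affineSpan ℝ {p, q} = axisLine p u := by
    ext x
    rw [mem_affineSpan_pair_iff_exists_lineMap_eq, mem_axisLine]
    simp only [AffineMap.lineMap_apply, hq, vsub_eq_sub, vadd_eq_add, add_sub_cancel_left, smul_smul]
    constructor
    · rintro ⟨d, rfl⟩
      exact ⟨d * c, by abel⟩
    · rintro ⟨d, rfl⟩
      exact ⟨d / c, by rw [div_mul_cancel₀ _ hc]; abel⟩
  rw [spheresCylinder, hspan, cylinder_axisLine hu hr]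
  intro x hx
  obtain ⟨d, rfl⟩ := mem_axisLine.1 hx
  rw [Set.mem_ofPred_eq, axisDistSq_add_smul hu, ← hp, axisDistSq, axisDistSq, norm_sub_rev,
    ← neg_sub p o, inner_neg_left, neg_sq]

/-- The two points have the same foot `m` on the axis. It lies on both spheres, so they are not
disjoint; both are tangent to the axis at `m`, and every point of the axis is equidistant from `p`
and `q`. -/
theorem specialPosition_of_orthogonal {o u p q : E3} {r : ℝ} (hr : 0 < r) (hu : ‖u‖ = 1)
    (hp : axisDistSq o u p = r ^ 2) (hq : axisDistSq o u q = r ^ 2) (h : ⟪q - p, u⟫ = 0) :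
    SpecialPosition (axisLine o u) p q r := by
  right; right
  set c := ⟪p - o, u⟫ with hc
  have hcq : ⟪q - o, u⟫ = c := by
    rw [hc, ← sub_add_sub_cancel q p o, inner_add_left, h, zero_add]
  set m := o + c • u with hm
  have key : ∀ x, axisDistSq o u x = r ^ 2 → ⟪x - o, u⟫ = c →
      ‖m - x‖ = r ∧ ⟪m - x, u⟫ = 0 := by
    intro x hx hxc
    have e : m - x = -(x - o - ⟪x - o, u⟫ • u) := by rw [hxc, hm]; abel
    constructor
    · rw [axisDistSq_eq_norm_sq hu] at hx
      rw [e, norm_neg]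
      exact (sq_eq_sq₀ (norm_nonneg _) hr.le).1 hx
    · rw [e, inner_neg_left, inner_sub_left, inner_smul_left, real_inner_self_eq_norm_sq, hu]
      simp
  have hmem : ∀ x ∈ axisLine o u, ∃ d : ℝ, x = m + d • u := by
    intro x hx
    obtain ⟨d, rfl⟩ := mem_axisLine.1 hx
    exact ⟨d - c, by rw [hm]; module⟩
  have tang : ∀ x, axisDistSq o u x = r ^ 2 → ⟪x - o, u⟫ = c →
      IsTangentToSphere (axisLine o u) x r := by
    intro x hx hxc
    obtain ⟨h1, h2⟩ := key x hx hxc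
    refine ⟨m, ?_, mem_axisLine.2 ⟨c, rfl⟩, ?_⟩
    · rw [EuclideanGeometry.mem_sphere, dist_eq_norm]
      exact h1
    · intro y hy
      obtain ⟨d, rfl⟩ := hmem y hy
      rw [EuclideanGeometry.Sphere.mem_orthRadius_iff_inner_left]
      simp only [vsub_eq_sub, add_sub_cancel_left]
      rw [inner_smul_left, real_inner_comm, h2, mul_zero]
  obtain ⟨p1, p2⟩ := key p hp rfl
  obtain ⟨q1, q2⟩ := key q hq hcq
  refine ⟨?_, isLine_axisLine o hu, tang p hp rfl, tang q hq hcq, ?_⟩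
  · rw [Set.not_disjoint_iff]
    refine ⟨m, ?_, ?_⟩
    · rw [mem_sphere_iff_norm]; exact p1
    · rw [mem_sphere_iff_norm]; exact q1
  · intro x hx
    obtain ⟨d, rfl⟩ := hmem x hx
    rw [AffineSubspace.mem_perpBisector_iff_dist_eq, dist_eq_norm, dist_eq_norm]
    have : ∀ y : E3, ‖m - y‖ = r → ⟪m - y, u⟫ = 0 → ‖m + d • u - y‖ ^ 2 = r ^ 2 + ‖d • u‖ ^ 2 := by
      intro y y1 y2
      rw [add_sub_right_comm, norm_add_sq_real, inner_smul_right, y2, y1]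
      ring
    rw [← sq_eq_sq₀ (norm_nonneg _) (norm_nonneg _), this p p1 p2, this q q1 q2]

theorem not_collinear_triple {p q s : E3} (hpq : p ≠ q) (h : ¬ ∃ c : ℝ, s = p + c • (q - p)) :
    ¬ Collinear ℝ ({p, q, s} : Set E3) := by
  intro hcol
  obtain ⟨v, hv⟩ := (collinear_iff_of_mem (p₀ := p) (by simp)).1 hcol
  obtain ⟨a, ha⟩ := hv q (by simp)
  obtain ⟨b, hb⟩ := hv s (by simp)
  rw [vadd_eq_add] at ha hb
  have ha0 : a ≠ 0 := by
    rintro rfl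
    simp at ha
    exact hpq ha.symm
  refine h ⟨b / a, ?_⟩
  rw [ha, add_sub_cancel_right, smul_smul, div_mul_cancel₀ _ ha0, hb, add_comm]

/-- The multiple `⟪f, f⟫ • g - ⟪f, g⟫ • f` of the component of `g` orthogonal to `f` is nonzero, and
its squared norm is `⟪f, f⟫` times the determinant. -/
theorem gramDet_pos_of_not_collinear {p q s : E3} (h : ¬ Collinear ℝ ({p, q, s} : Set E3)) :
    0 < gramDet ⟪q - p, q - p⟫ ⟪q - p, s - p⟫ ⟪s - p, s - p⟫ := by
  have hqp : q - p ≠ 0 := sub_ne_zero.2 (ne₁₂_of_not_collinear h).symm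
  have hα : 0 < ⟪q - p, q - p⟫ := real_inner_self_pos.2 hqp
  set f := q - p with hf
  set g := s - p with hg
  have hkey : ‖⟪f, f⟫ • g - ⟪f, g⟫ • f‖ ^ 2 = ⟪f, f⟫ * gramDet ⟪f, f⟫ ⟪f, g⟫ ⟪g, g⟫ := by
    rw [← real_inner_self_eq_norm_sq, real_inner_sub_sub_self (⟪f, f⟫ • g) (⟪f, g⟫ • f)]
    simp only [inner_smul_left, inner_smul_right, conj_trivial]
    rw [real_inner_comm f g, gramDet]
    ring
  have hne : ⟪f, f⟫ • g - ⟪f, g⟫ • f ≠ 0 := by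
    intro h0
    apply h
    rw [collinear_iff_of_mem (p₀ := p) (by simp)]
    refine ⟨f, ?_⟩
    have hg' : g = (⟪f, g⟫ / ⟪f, f⟫) • f := by
      rw [sub_eq_zero] at h0
      rw [div_eq_inv_mul, mul_smul, ← h0, smul_smul, inv_mul_cancel₀ hα.ne', one_smul]
    rintro x (rfl | rfl | rfl)
    · exact ⟨0, by simp⟩
    · exact ⟨1, by simp [hf]⟩
    · exact ⟨_, by rw [← hg', hg]; simp⟩
  have hpos : 0 < ‖⟪f, f⟫ • g - ⟪f, g⟫ • f‖ ^ 2 := by positivity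
  rw [hkey] at hpos
  exact pos_of_mul_pos_right hpos hα.le

/-- If a line is parallel to the plane of three points that are equally far from it, then it is
parallel to a side of their triangle. -/
theorem parallel_side_of_coplanar {o u n p q s : E3} {r : ℝ} (hu : ‖u‖ = 1) (hn : ‖n‖ = 1)
    (hnu : ⟪n, u⟫ = 0) (hq' : ⟪n, q - p⟫ = 0) (hs' : ⟪n, s - p⟫ = 0)
    (hp : axisDistSq o u p = r ^ 2) (hq : axisDistSq o u q = r ^ 2)
    (hs : axisDistSq o u s = r ^ 2) :
    ‖q - p‖ ^ 2 = ⟪q - p, u⟫ ^ 2 ∨ ‖s - p‖ ^ 2 = ⟪s - p, u⟫ ^ 2 ∨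
      ‖q - s‖ ^ 2 = ⟪q - s, u⟫ ^ 2 := by
  have hnorm : ∀ v : E3, ‖v‖ ^ 2 = ⟪u, v⟫ ^ 2 + ⟪n, v⟫ ^ 2 + ⟪cross u n, v⟫ ^ 2 := by
    intro v
    have := (frame hu hn hnu).sum_sq_norm_inner_right v
    rw [← this]
    simp [Fin.sum_univ_three, frame_apply]
  have hd : ∀ x, axisDistSq o u x = ⟪n, x - o⟫ ^ 2 + ⟪cross u n, x - o⟫ ^ 2 := by
    intro x
    rw [axisDistSq, hnorm, real_inner_comm u]
    ring
  have e : ∀ x y : E3, x - y = (x - o) - (y - o) := fun x y => by abel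
  rw [e, inner_sub_right] at hq' hs'
  have side : ∀ x y, ⟪n, x - o⟫ - ⟪n, y - o⟫ = 0 → ⟪cross u n, x - o⟫ = ⟪cross u n, y - o⟫ →
      ‖x - y‖ ^ 2 = ⟪x - y, u⟫ ^ 2 := by
    intro x y h1 h2
    rw [hnorm, real_inner_comm u, e x y, inner_sub_right n, inner_sub_right (cross u n), h1, h2]
    ring
  rw [hd] at hp hq hs
  have hNq : ⟪n, q - o⟫ = ⟪n, p - o⟫ := by linarith
  have hNs : ⟪n, s - o⟫ = ⟪n, p - o⟫ := by linarith
  rw [hNq] at hq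
  rw [hNs] at hs
  -- Seen along the axis, the three points lie on a circle and on a line, which share at most two
  -- points; so two projections coincide.
  rcases sq_eq_sq_iff_eq_or_eq_neg.1 (show ⟪cross u n, q - o⟫ ^ 2 = ⟪cross u n, p - o⟫ ^ 2 by linarith)
    with h1 | h1
  · exact Or.inl (side q p hq' h1)
  rcases sq_eq_sq_iff_eq_or_eq_neg.1 (show ⟪cross u n, s - o⟫ ^ 2 = ⟪cross u n, p - o⟫ ^ 2 by linarith)
    with h2 | h2
  · exact Or.inr (Or.inl (side s p hs' h2))
  · exact Or.inr (Or.inr (side q s (by linarith) (by rw [h1, h2])))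

/-! ### Extreme axes and the conclusion. -/

/-- The cylinder around the line passes through four points that are not collinear, or through
three points with the line in a special position. -/
def IsExtremeAxis (P : Finset E3) (r : ℝ) (l : AffineSubspace ℝ E3) : Prop :=
  (∃ Q : Finset E3, Q ⊆ P ∧ Q.card = 4 ∧ ¬ Collinear ℝ (Q : Set E3) ∧ (Q : Set E3) ⊆ cylinder l r) ∨
    (∃ Q : Finset E3, Q ⊆ P ∧ Q.card = 3 ∧ ¬ Collinear ℝ (Q : Set E3) ∧
      (Q : Set E3) ⊆ cylinder l r ∧ ∃ p ∈ Q, ∃ q ∈ Q, p ≠ q ∧ SpecialPosition l p q r)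

/-- The line through `o` with direction `u` is at distance `r` from the vertices of a triangle
of points of `P`. -/
structure TouchesTriangle (P : Finset E3) (r : ℝ) (o u p q s : E3) : Prop where
  mem_fst : p ∈ P
  mem_snd : q ∈ P
  mem_trd : s ∈ P
  not_collinear : ¬ Collinear ℝ ({p, q, s} : Set E3)
  fst : axisDistSq o u p = r ^ 2
  snd : axisDistSq o u q = r ^ 2
  trd : axisDistSq o u s = r ^ 2

theorem TouchesTriangle.swap₁₂ {P : Finset E3} {r : ℝ} {o u p q s : E3}
    (h : TouchesTriangle P r o u p q s) : TouchesTriangle P r o u q p s :=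
  ⟨h.2, h.1, h.3, by rw [Set.insert_comm]; exact h.4, h.6, h.5, h.7⟩

theorem TouchesTriangle.swap₂₃ {P : Finset E3} {r : ℝ} {o u p q s : E3}
    (h : TouchesTriangle P r o u p q s) : TouchesTriangle P r o u p s q :=
  ⟨h.1, h.3, h.2, by rw [Set.pair_comm]; exact h.4, h.5, h.7, h.6⟩

theorem TouchesTriangle.isExtremeAxis {P : Finset E3} {r : ℝ} (hr : 0 < r) {o u p q s : E3}
    (hu : ‖u‖ = 1) (h : TouchesTriangle P r o u p q s)
    (hsp : SpecialPosition (axisLine o u) p q r) : IsExtremeAxis P r (axisLine o u) := by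
  classical
  right
  refine ⟨{p, q, s}, ?_, ?_, by simpa using h.not_collinear, ?_, p, by simp, q, by simp,
    ne₁₂_of_not_collinear h.not_collinear, hsp⟩
  · intro x hx
    simp only [Finset.mem_insert, Finset.mem_singleton] at hx
    rcases hx with rfl | rfl | rfl
    exacts [h.mem_fst, h.mem_snd, h.mem_trd]
  · exact Finset.card_eq_three.2 ⟨p, q, s, ne₁₂_of_not_collinear h.not_collinear,
      ne₁₃_of_not_collinear h.not_collinear, ne₂₃_of_not_collinear h.not_collinear, rfl⟩
  · rw [cylinder_axisLine hu hr]
    intro x hx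
    simp only [Finset.coe_insert, Finset.coe_singleton, Set.mem_insert_iff,
      Set.mem_singleton_iff] at hx
    rcases hx with rfl | rfl | rfl
    exacts [h.fst, h.snd, h.trd]

theorem TouchesTriangle.isExtremeAxis_of_parallel {P : Finset E3} {r : ℝ} (hr : 0 < r)
    {o u p q s : E3} (hu : ‖u‖ = 1) (h : TouchesTriangle P r o u p q s)
    (hpar : ‖q - p‖ ^ 2 = ⟪q - p, u⟫ ^ 2) : IsExtremeAxis P r (axisLine o u) :=
  h.isExtremeAxis hr hu
    (specialPosition_of_parallel hr hu h.fst (ne₁₂_of_not_collinear h.not_collinear) hpar)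

theorem TouchesTriangle.isExtremeAxis_of_orthogonal {P : Finset E3} {r : ℝ} (hr : 0 < r)
    {o u p q s : E3} (hu : ‖u‖ = 1) (h : TouchesTriangle P r o u p q s)
    (horth : ⟪q - p, u⟫ = 0) : IsExtremeAxis P r (axisLine o u) :=
  h.isExtremeAxis hr hu (specialPosition_of_orthogonal hr hu h.fst h.snd horth)

theorem TouchesTriangle.isExtremeAxis_of_fourth {P : Finset E3} {r : ℝ} (hr : 0 < r)
    {o u p q s x : E3} (hu : ‖u‖ = 1) (h : TouchesTriangle P r o u p q s) (hx : x ∈ P)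
    (hxp : x ≠ p) (hxq : x ≠ q) (hxs : x ≠ s) (hxd : axisDistSq o u x = r ^ 2) :
    IsExtremeAxis P r (axisLine o u) := by
  classical
  left
  refine ⟨{x, p, q, s}, ?_, ?_, ?_, ?_⟩
  · intro y hy
    simp only [Finset.mem_insert, Finset.mem_singleton] at hy
    rcases hy with rfl | rfl | rfl | rfl
    exacts [hx, h.mem_fst, h.mem_snd, h.mem_trd]
  · exact Finset.card_eq_four.2 ⟨x, p, q, s, hxp, hxq, hxs, ne₁₂_of_not_collinear h.not_collinear,
      ne₁₃_of_not_collinear h.not_collinear, ne₂₃_of_not_collinear h.not_collinear, rfl⟩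
  · intro hcol
    exact h.not_collinear (hcol.subset (by simp [Set.subset_def]))
  · rw [cylinder_axisLine hu hr]
    intro y hy
    simp only [Finset.coe_insert, Finset.coe_singleton, Set.mem_insert_iff,
      Set.mem_singleton_iff] at hy
    rcases hy with rfl | rfl | rfl | rfl
    exacts [hxd, h.fst, h.snd, h.trd]

theorem AxisMoves.refl {P : Finset E3} {r : ℝ} (hr : 0 < r) {o u : E3} (hu : ‖u‖ = 1)
    (h : ∀ x ∈ P, axisDistSq o u x ≤ r ^ 2) : AxisMoves P r o u o u := by
  obtain ⟨k, hk, hku⟩ := exists_unit_orthogonal u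
  exact ⟨hu, h, exists_motion (o := fun _ => o) (u := fun _ => u) (k := fun _ => k)
    continuous_const continuous_const continuous_const (fun _ => hu) (fun _ => hk) (fun _ => hku) hr
    (fun _ => h)⟩

/-- The normal `n` is oriented towards `u`. If `u` is parallel to the plane, the axis is already
parallel to a side; otherwise the touching motion runs until a fourth point is met or its special
end is reached. -/
theorem TouchesTriangle.exists_extreme_of_ordered {P : Finset E3} {r : ℝ} (hr : 0 < r)
    {o u p q s : E3} (hu : ‖u‖ = 1) (hP : ∀ x ∈ P, axisDistSq o u x ≤ r ^ 2)
    (h : TouchesTriangle P r o u p q s) (hps : ⟪u, p⟫ < ⟪u, s⟫) (hsq : ⟪u, s⟫ < ⟪u, q⟫) :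
    ∃ o' u', AxisMoves P r o u o' u' ∧ IsExtremeAxis P r (axisLine o' u') := by
  have hΔ := gramDet_pos_of_not_collinear h.not_collinear
  have hα : 0 < ⟪q - p, q - p⟫ :=
    real_inner_self_pos.2 (sub_ne_zero.2 (ne₁₂_of_not_collinear h.not_collinear).symm)
  obtain ⟨n, hn, hn₁, hn₂, hun⟩ : ∃ n : E3, ‖n‖ = 1 ∧ ⟪n, q - p⟫ = 0 ∧ ⟪n, s - p⟫ = 0 ∧
      0 ≤ ⟪u, n⟫ := by
    obtain ⟨n, hn, hn₁, hn₂⟩ := exists_unit_orthogonal_pair (q - p) (s - p)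
    rcases le_total 0 ⟪u, n⟫ with h0 | h0
    · exact ⟨n, hn, hn₁, hn₂, h0⟩
    · refine ⟨-n, by rw [norm_neg, hn], ?_, ?_, ?_⟩
      · rw [inner_neg_left, hn₁, neg_zero]
      · rw [inner_neg_left, hn₂, neg_zero]
      · rw [inner_neg_right]; linarith
  have finish : ∀ {w v : E3}, ‖v‖ = 1 → TouchesTriangle P r w v p q s →
      (‖q - p‖ ^ 2 = ⟪q - p, v⟫ ^ 2 ∨ ‖s - p‖ ^ 2 = ⟪s - p, v⟫ ^ 2 ∨
      ‖q - s‖ ^ 2 = ⟪q - s, v⟫ ^ 2) → IsExtremeAxis P r (axisLine w v) := by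
    rintro w v hv hT (h1 | h1 | h1)
    · exact hT.isExtremeAxis_of_parallel hr hv h1
    · exact hT.swap₂₃.isExtremeAxis_of_parallel hr hv h1
    · exact hT.swap₂₃.swap₁₂.swap₂₃.isExtremeAxis_of_parallel hr hv h1
  rcases hun.eq_or_lt with h0 | h0
  · exact ⟨o, u, AxisMoves.refl hr hu hP, finish hu h (parallel_side_of_coplanar hu hn
      (by rw [real_inner_comm]; exact h0.symm) hn₁ hn₂ h.fst h.snd h.trd)⟩
  obtain ⟨w, v, k, hwc, hvc, hkc, hv1, hk1, hkv, htouch, hv0, ⟨c, hw0⟩, hend⟩ :=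
    exists_touching_motion hr hu h.fst h.snd h.trd hα hΔ hn hn₁ hn₂ h0
      (by rw [inner_sub_right]; linarith) (by rw [inner_sub_right, inner_sub_right]; linarith)
  obtain ⟨t, ht, hhit⟩ := exists_motion_until_hit (P := P) hr (fun x => x ≠ p ∧ x ≠ q ∧ x ≠ s)
    hwc hvc hkc hv1 hk1 hkv
    (by rw [hv0, hw0]; simpa only [axisDistSq_origin_add_smul hu] using hP)
    (by
      intro x _ hx t
      obtain ⟨t1, t2, t3⟩ := htouch t
      have : x = p ∨ x = q ∨ x = s := by tauto
      rcases this with rfl | rfl | rfl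
      exacts [t1.le, t2.le, t3.le])
  rw [hv0, hw0, AxisMoves, axisLine_add_smul, ← AxisMoves] at ht
  have hT : TouchesTriangle P r (w t) (v t) p q s :=
    ⟨h.mem_fst, h.mem_snd, h.mem_trd, h.not_collinear, (htouch t).1, (htouch t).2.1, (htouch t).2.2⟩
  refine ⟨w t, v t, ht, ?_⟩
  rcases hhit with rfl | ⟨x, hx, ⟨hxp, hxq, hxs⟩, hxd⟩
  · rcases hend with h1 | h1 | h1
    · exact hT.swap₂₃.isExtremeAxis_of_orthogonal hr (hv1 1) h1
    · exact hT.swap₂₃.swap₁₂.swap₂₃.isExtremeAxis_of_orthogonal hr (hv1 1) h1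
    · exact finish (hv1 1) hT h1
  · exact hT.isExtremeAxis_of_fourth hr (hv1 t) hx hxp hxq hxs hxd

/-- Equal heights of two vertices give an axis orthogonal to a side with no motion at all; distinct
heights are put in order by relabelling. -/
theorem TouchesTriangle.exists_extreme {P : Finset E3} {r : ℝ} (hr : 0 < r) {o u p q s : E3}
    (hu : ‖u‖ = 1) (hP : ∀ x ∈ P, axisDistSq o u x ≤ r ^ 2)
    (h : TouchesTriangle P r o u p q s) :
    ∃ o' u', AxisMoves P r o u o' u' ∧ IsExtremeAxis P r (axisLine o' u') := by
  have heq : ∀ {a b c : E3}, TouchesTriangle P r o u a b c → ⟪u, a⟫ = ⟪u, b⟫ →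
      ∃ o' u', AxisMoves P r o u o' u' ∧ IsExtremeAxis P r (axisLine o' u') := by
    intro a b c hT hab
    refine ⟨o, u, AxisMoves.refl hr hu hP, hT.isExtremeAxis_of_orthogonal hr hu ?_⟩
    rw [real_inner_comm, inner_sub_right, hab, sub_self]
  rcases lt_trichotomy ⟪u, p⟫ ⟪u, q⟫ with h1 | h1 | h1
  · rcases lt_trichotomy ⟪u, q⟫ ⟪u, s⟫ with h2 | h2 | h2
    · exact h.swap₂₃.exists_extreme_of_ordered hr hu hP h1 h2
    · exact heq h.swap₁₂.swap₂₃ h2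
    · rcases lt_trichotomy ⟪u, p⟫ ⟪u, s⟫ with h3 | h3 | h3
      · exact h.exists_extreme_of_ordered hr hu hP h3 h2
      · exact heq h.swap₂₃ h3
      · exact h.swap₂₃.swap₁₂.swap₂₃.exists_extreme_of_ordered hr hu hP h3 h1
  · exact heq h h1
  · rcases lt_trichotomy ⟪u, p⟫ ⟪u, s⟫ with h2 | h2 | h2
    · exact h.swap₁₂.swap₂₃.exists_extreme_of_ordered hr hu hP h1 h2
    · exact heq h.swap₂₃ h2
    · rcases lt_trichotomy ⟪u, q⟫ ⟪u, s⟫ with h3 | h3 | h3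
      · exact h.swap₁₂.exists_extreme_of_ordered hr hu hP h3 h2
      · exact heq h.swap₁₂.swap₂₃ h3
      · exact h.swap₂₃.swap₁₂.exists_extreme_of_ordered hr hu hP h3 h1

theorem exists_not_mem_line {P : Finset E3} (hP : ¬ Collinear ℝ (P : Set E3)) (p v : E3) :
    ∃ x ∈ P, ¬ ∃ c : ℝ, x = p + c • v := by
  by_contra! hcon
  refine hP ((collinear_iff_exists_forall_eq_smul_vadd _).2 ⟨p, v, fun x hx => ?_⟩)
  obtain ⟨c, hc⟩ := hcon x hx
  exact ⟨c, by rw [hc, vadd_eq_add, add_comm]⟩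

theorem mainTheorem2 (P : Finset E3) (hcard : 4 ≤ P.card) (hP : ¬ Collinear ℝ (P : Set E3))
    (r : ℝ) (hr : 0 < r) (l : AffineSubspace ℝ E3) (hl : IsLine l)
    (hC : EnclosedIn (P : Set E3) (cylinder l r)) :
    ∃ l' : AffineSubspace ℝ E3, IsLine l' ∧
      EnclosedIn (P : Set E3) (cylinder l' r) ∧
      ((∃ Q : Finset E3, Q ⊆ P ∧ Q.card = 4 ∧ ¬ Collinear ℝ (Q : Set E3) ∧
          (Q : Set E3) ⊆ cylinder l' r) ∨
        (∃ Q : Finset E3, Q ⊆ P ∧ Q.card = 3 ∧ ¬ Collinear ℝ (Q : Set E3) ∧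
          (Q : Set E3) ⊆ cylinder l' r ∧
          ∃ p ∈ Q, ∃ q ∈ Q, p ≠ q ∧ SpecialPosition l' p q r)) ∧
      MovesTo (P : Set E3) (cylinder l r) (cylinder l' r) := by
  obtain ⟨o, u, hu, rfl⟩ := hl.exists_eq_axisLine
  rw [enclosedIn_cylinder hu hr] at hC
  obtain ⟨x₀, hx₀⟩ : P.Nonempty := Finset.card_pos.1 (by omega)
  obtain ⟨o₁, hm₁, p, hp, hpd⟩ := exists_axisMoves_touch_one hr hu hC hx₀
  obtain ⟨x₁, hx₁, hx₁p⟩ := exists_not_mem_line hP p u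
  obtain ⟨o₂, hm₂, hpd₂, q, hq, hqd, hpq⟩ := exists_axisMoves_touch_two hr hu hm₁.2.1 hpd hx₁ hx₁p
  obtain ⟨x₂, hx₂, hx₂p⟩ := exists_not_mem_line hP p (q - p)
  obtain ⟨o₃, u₃, hm₃, hpd₃, hqd₃, s, hs, hsd, hspq⟩ :=
    exists_axisMoves_touch_three hr hu hm₂.2.1 hpd₂ hqd hpq hx₂ hx₂p
  have hne : p ≠ q := fun h => hpq ⟨0, by rw [h]; simp⟩
  obtain ⟨o', u', hm, hext⟩ := TouchesTriangle.exists_extreme hr hm₃.1 hm₃.2.1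
    ⟨hp, hq, hs, not_collinear_triple hne hspq, hpd₃, hqd₃, hsd⟩
  have hmove := ((hm₁.trans hm₂).trans hm₃).trans hm
  exact ⟨axisLine o' u', isLine_axisLine o' hm.1, (enclosedIn_cylinder hm.1 hr).2 hm.2.1, hext,
    hmove.2.2⟩
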